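/- Let $k$ be an algebraically closed field of characteristic zero, $\mathfrak g$ a finite-dimensional simple Lie algebra over $k$ not of type $G_2$, $\mathfrak h$ a Cartan subalgebra, $\pi=\{\alpha_i\}_{i\in I}$ a set of simple roots, $\Delta^+$ the corresponding positive roots and $\Delta^{\vee+}=\{\gamma^\vee:\gamma\in\Delta^+\}$ the positive coroots. Put $m_{i,j}=\alpha_i(\alpha_j^\vee)\,\alpha_j(\alpha_i^\vee)$. The Zhelobenko monoid is defined by generators and relations. Consider the words $A_{i_1}\cdots A_{i_r}P_k$ ($r\ge 0$, $i_1,\dots,i_r,k\in I$) together with $0$, modulo the relations below. A relation between operators may be applied at any place in a word, a relation starting on $P_k$ may be preceded by arbitrary operators, and elements differing only by a sign are identified: $A_i^2=0$ and $A_iP_i=0$; if $m_{i,j}=0$: $A_iA_j=A_jA_i$ and $A_iP_j=0$; if $m_{i,j}=1$: $A_iA_jA_i=A_jA_iA_j$ and $A_iP_j=-A_jP_i$; if $m_{i,j}=2$: $(A_iA_j)^2=(A_jA_i)^2$ and $A_jA_iP_j=-A_iA_jP_i$; if $m_{i,j}=3$: $(A_iA_j)^3=(A_jA_i)^3$ and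 $(A_jA_i)^2P_j=-(A_iA_j)^2P_i$. Let $\mathbf P$ be the set of non-zero elements. The operators $A_i=A_{\alpha_i^\vee}$ act as maps $\mathbf P\cup\{0\}\to\mathbf P\cup\{0\}$. The length of $A_{i_1}\cdots A_{i_r}P_k\in\mathbf P$ is $r+1$. Then there is an injective map $\mathscr P:\Delta^{\vee+}\to\mathbf P$ with the following properties. (a) $\mathscr P(\alpha_i^\vee)=P_i$ for all $i\in I$, and every word representing $\mathscr P(\gamma^\vee)$ has length equal to the sum of the coefficients of $\gamma^\vee$ with respect to the simple coroots. (b) Let $\alpha\in\pi$ and $\gamma\in\Delta^+$ with $\alpha(\gamma^\vee)=-1$. Whenever $A_{\alpha^\vee}\mathscr P(\gamma^\vee)$ lies in the image of $\mathscr P$, one has $A_{\alpha^\vee}\mathscr P(\gamma^\vee)=\mathscr P(s_\alpha\gamma^\vee)$. Moreover $A_{\alpha^\vee}\mathscr P(\gamma^\vee)$ does always lie in the image of $\mathscr P$ in this case. (c) If $\alpha\in\pi$ and $\gamma\in\Delta^+$ are such that $\gamma^\vee+\alpha^\vee$ and $\gamma^\vee-\alpha^\vee$ are both coroots, then $A_{\alpha^\vee}\mathscr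 P(\gamma^\vee)=\mathscr P(\alpha^\vee+\gamma^\vee)$. (d) If $\alpha\in\pi$ and $\gamma\in\Delta^+$ are such that neither $\gamma^\vee+\alpha^\vee$ nor $\gamma^\vee-\alpha^\vee$ is a coroot, then $A_{\alpha^\vee}\mathscr P(\gamma^\vee)=0$. (e) In types $B_n$ and $C_n$ ($n\ge 2$, simple roots labelled $1,\dots,n$ as in Bourbaki) write $[i,j]=A_iA_{i-1}\cdots A_{j+1}P_j$ for $i\ge j$ and $[i,n,j]=A_iA_{i+1}\cdots A_{n-1}A_nA_{n-1}\cdots A_{j+1}P_j$, where $[i,n,n]=A_i\cdots A_{n-1}P_n$. Let $\varepsilon_1,\dots,\varepsilon_n\in\mathfrak h$ be given by $\alpha_i^\vee=\varepsilon_i-\varepsilon_{i+1}$ for $i<n$, with $\alpha_n^\vee=2\varepsilon_n$ in type $B_n$ and $\alpha_n^\vee=\varepsilon_n$ in type $C_n$. In both types $\mathscr P(\varepsilon_j-\varepsilon_{i+1})=[i,j]$ for $1\le j\le i\le n-1$. In type $B_n$, $\mathscr P(\varepsilon_j+\varepsilon_i)=[i,n,j]$ for $1\le j\le i\le n$. In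 type $C_n$, $\mathscr P(\varepsilon_i+\varepsilon_j)=[i,n,j-1]$ for $1\le i<j\le n$ and $\mathscr P(\varepsilon_i)=[i,n,n]$ for $1\le i\le n$. -/

import Mathlib

/-! The Zhelobenko monoid `(𝐀, 𝐏)` attached to a Cartan matrix, elements being identified when they
differ by a sign. The Cartan matrix is `C i j = ⟨α_i, α_j^∨⟩`, and `m_{i,j} = C i j * C j i`. -/

namespace Zhelobenko

variable {I : Type*}

/-- Formal expressions: `some ([i₁, …, i_r], k)` is the word `A_{i₁} ⋯ A_{i_r} P_k`, and `none` is
the zero expression. -/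
abbrev Expr (I : Type*) := Option (List I × I)

/-- The defining relations, in which signs are dropped because elements that differ by a sign are
identified. In each relation the word `u` of letters `A_i` on the left is arbitrary. -/
inductive Step (C : Matrix I I ℤ) : Expr I → Expr I → Prop
  /-- `A_i² = 0` -/
  | sq (u v : List I) (i k : I) :
      Step C (some (u ++ [i, i] ++ v, k)) none
  /-- `A_i P_i = 0` -/
  | kill (u : List I) (i : I) :
      Step C (some (u ++ [i], i)) none
  /-- `A_i A_j = A_j A_i` if `m_{i,j} = 0` -/
  | comm (u v : List I) (i j k : I) : C i j * C j i = 0 →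
      Step C (some (u ++ [i, j] ++ v, k)) (some (u ++ [j, i] ++ v, k))
  /-- `A_i P_j = 0` if `m_{i,j} = 0` -/
  | orth (u : List I) (i j : I) : C i j * C j i = 0 →
      Step C (some (u ++ [i], j)) none
  /-- `A_i A_j A_i = A_j A_i A_j` if `m_{i,j} = 1` -/
  | braid₁ (u v : List I) (i j k : I) : C i j * C j i = 1 →
      Step C (some (u ++ [i, j, i] ++ v, k)) (some (u ++ [j, i, j] ++ v, k))
  /-- `A_i P_j = ± A_j P_i` if `m_{i,j} = 1` -/
  | swap₁ (u : List I) (i j : I) : C i j * C j i = 1 →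
      Step C (some (u ++ [i], j)) (some (u ++ [j], i))
  /-- `(A_i A_j)² = (A_j A_i)²` if `m_{i,j} = 2` -/
  | braid₂ (u v : List I) (i j k : I) : C i j * C j i = 2 →
      Step C (some (u ++ [i, j, i, j] ++ v, k)) (some (u ++ [j, i, j, i] ++ v, k))
  /-- `A_j A_i P_j = ± A_i A_j P_i` if `m_{i,j} = 2` -/
  | swap₂ (u : List I) (i j : I) : C i j * C j i = 2 →
      Step C (some (u ++ [j, i], j)) (some (u ++ [i, j], i))
  /-- `(A_i A_j)³ = (A_j A_i)³` if `m_{i,j} = 3` -/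
  | braid₃ (u v : List I) (i j k : I) : C i j * C j i = 3 →
      Step C (some (u ++ [i, j, i, j, i, j] ++ v, k)) (some (u ++ [j, i, j, i, j, i] ++ v, k))
  /-- `(A_j A_i)² P_j = ± (A_i A_j)² P_i` if `m_{i,j} = 3` -/
  | swap₃ (u : List I) (i j : I) : C i j * C j i = 3 →
      Step C (some (u ++ [j, i, j, i], j)) (some (u ++ [i, j, i, j], i))

/-- The pointed set `𝐏 ∪ {0}`: the quotient of the formal expressions by the equivalence relation
generated by the defining relations. -/
def PointedMonoid (C : Matrix I I ℤ) : Type _ := Quot (Step C)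

variable {C : Matrix I I ℤ}

instance : Zero (PointedMonoid C) := ⟨Quot.mk _ none⟩

/-- The element `A_{i₁} ⋯ A_{i_r} P_k` of `𝐏 ∪ {0}`, where `u = [i₁, …, i_r]`. -/
def word (C : Matrix I I ℤ) (u : List I) (k : I) : PointedMonoid C := Quot.mk _ (some (u, k))

/-- Prefixing a letter to a formal expression. -/
def Expr.cons (i : I) : Expr I → Expr I := Option.map fun w ↦ (i :: w.1, w.2)

lemma Step.cons (i : I) {x y : Expr I} (h : Step C x y) : Step C (x.cons i) (y.cons i) := by
  cases h with
  | sq u v j k => exact Step.sq (i :: u) v j k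
  | kill u j => exact Step.kill (i :: u) j
  | comm u v j j' k h => exact Step.comm (i :: u) v j j' k h
  | orth u j j' h => exact Step.orth (i :: u) j j' h
  | braid₁ u v j j' k h => exact Step.braid₁ (i :: u) v j j' k h
  | swap₁ u j j' h => exact Step.swap₁ (i :: u) j j' h
  | braid₂ u v j j' k h => exact Step.braid₂ (i :: u) v j j' k h
  | swap₂ u j j' h => exact Step.swap₂ (i :: u) j j' h
  | braid₃ u v j j' k h => exact Step.braid₃ (i :: u) v j j' k h
  | swap₃ u j j' h => exact Step.swap₃ (i :: u) j j' h

/-- The operator `A_i` on `𝐏 ∪ {0}`. -/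
def op (i : I) : PointedMonoid C → PointedMonoid C :=
  Quot.map (Expr.cons i) fun _ _ h ↦ h.cons i

/-- The set `𝐏`, that is, the non-zero elements `A_{i₁} ⋯ A_{i_r} P_k` (up to sign). -/
def Elt (C : Matrix I I ℤ) : Type _ := {x : PointedMonoid C // x ≠ 0}

section Strings

variable {n : ℕ}

/-- For `j ≤ i`, the element `[i, j] = A_i A_{i-1} ⋯ A_{j+1} P_j`, where the simple roots are
labelled by `e`. -/
def down (C : Matrix I I ℤ) (e : Fin n → I) (i j : Fin n) : PointedMonoid C :=
  word C ((((List.finRange n).filter fun k ↦ j < k ∧ k ≤ i).reverse).map e) (e j)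

/-- The element `[i, n, j] = A_i A_{i+1} ⋯ A_{n-1} A_n A_{n-1} ⋯ A_{j+1} P_j`, where the simple
roots are labelled by `e`, the label `n` being the last element of `Fin n`. For `j = n` this is
`A_i A_{i+1} ⋯ A_{n-1} P_n`. -/
def upDown (C : Matrix I I ℤ) (e : Fin n → I) (i j : Fin n) : PointedMonoid C :=
  word C ((((List.finRange n).filter fun k ↦ i ≤ k ∧ k.val + 1 < n) ++
    ((List.finRange n).filter fun k ↦ j < k).reverse).map e) (e j)

end Strings

section RootSystem

variable {ι R M N : Type*} [CommRing R] [CharZero R] [AddCommGroup M] [Module R M]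
  [AddCommGroup N] [Module R N] {P : RootPairing ι R M N} [P.IsCrystallographic]

/-- The indices of the positive (co)roots; the index `γ` stands for the positive coroot
`γ^∨ = P.coroot γ`. -/
abbrev PosCoroot (b : P.Base) : Type _ := {γ : ι // b.IsPos γ}

/-- The explicit form of the map `Φ` in type `B_n`, `n ≥ 2`. For any labelling `e` of the simple
roots which gives the Cartan matrix of type `B_n`, let `ε` be the vectors with
`α_i^∨ = ε_i - ε_{i+1}` for `i < n` and `α_n^∨ = 2 ε_n`. Then `ε_j - ε_{i+1} ↦ [i, j]` for
`j ≤ i < n` and `ε_j + ε_i ↦ [i, n, j]` for `j ≤ i`. -/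
def IsStandardB (b : P.Base) (Φ : PosCoroot b → Elt b.cartanMatrix) : Prop :=
  ∀ (n : ℕ) (e : Fin n ≃ b.support) (ε : Fin n → N), 2 ≤ n →
    (∀ i j, b.cartanMatrix (e i) (e j) = CartanMatrix.B n i j) →
    (∀ i j : Fin n, j.val = i.val + 1 → P.coroot (e i) = ε i - ε j) →
    (∀ i : Fin n, i.val + 1 = n → P.coroot (e i) = (2 : ℕ) • ε i) →
    (∀ i j k : Fin n, j ≤ i → k.val = i.val + 1 →
      ∃ γ : PosCoroot b, P.coroot γ = ε j - ε k ∧ (Φ γ).1 = down _ e i j) ∧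
    (∀ i j : Fin n, j ≤ i →
      ∃ γ : PosCoroot b, P.coroot γ = ε j + ε i ∧ (Φ γ).1 = upDown _ e i j)

/-- The explicit form of the map `Φ` in type `C_n`, `n ≥ 2`. For any labelling `e` of the simple
roots which gives the Cartan matrix of type `C_n`, let `ε` be the vectors with
`α_i^∨ = ε_i - ε_{i+1}` for `i < n` and `α_n^∨ = ε_n`. Then `ε_j - ε_{i+1} ↦ [i, j]` for
`j ≤ i < n`, `ε_i + ε_j ↦ [i, n, j-1]` for `i < j`, and `ε_i ↦ [i, n, n]`. -/
def IsStandardC (b : P.Base) (Φ : PosCoroot b → Elt b.cartanMatrix) : Prop :=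
  ∀ (n : ℕ) (e : Fin n ≃ b.support) (ε : Fin n → N), 2 ≤ n →
    (∀ i j, b.cartanMatrix (e i) (e j) = CartanMatrix.C n i j) →
    (∀ i j : Fin n, j.val = i.val + 1 → P.coroot (e i) = ε i - ε j) →
    (∀ i : Fin n, i.val + 1 = n → P.coroot (e i) = ε i) →
    (∀ i j k : Fin n, j ≤ i → k.val = i.val + 1 →
      ∃ γ : PosCoroot b, P.coroot γ = ε j - ε k ∧ (Φ γ).1 = down _ e i j) ∧
    (∀ i j k : Fin n, i < j → j.val = k.val + 1 →
      ∃ γ : PosCoroot b, P.coroot γ = ε i + ε j ∧ (Φ γ).1 = upDown _ e i k) ∧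
    (∀ i k : Fin n, k.val + 1 = n →
      ∃ γ : PosCoroot b, P.coroot γ = ε i ∧ (Φ γ).1 = upDown _ e i k)

end RootSystem

end Zhelobenko

set_option linter.unusedSectionVars false

/-! Identify a coroot with its vector of coefficients over the simple coroots. A positive coroot v
that is not simple has a simple root α_i with α_i(v) > 0, and v - α_i^∨ is then again a positive
coroot; set 𝒫(v) = A_i 𝒫(v - α_i^∨). That the choice of i is immaterial (`path_unique`) is a diamond
argument on heights. By `two_descents`, two descents i ≠ j are either orthogonal, and A_iA_j =
A_jA_i closes the diamond, or v = α_i^∨ + α_j^∨, where A_iP_j = A_jP_i. By construction A_i 𝒫(v) =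
𝒫(v + α_i^∨) whenever the sum is a coroot and α_i(v) ≥ -1 (`elt_add`), which gives (b) and (c).
Excluding G₂ bounds all pairings by 2 in absolute value, so that there are at most two lengths, of
ratio 2.

For (d), if α_i(v) > 0 then 𝒫(v) begins with A_i or is P_i, and A_i kills it. If α_i(v) = 0, an
induction on the height moves A_i past a descent A_j by the relation for m_{i,j}
(`op_elt_of_middle_aux`). The case that resists is A_iA_jA_i acting on a short coroot orthogonal to
α_i and α_j, which needs its own induction (`op_op_op_elt_eq_zero`).

It remains to see that the relations do not collapse 𝒫. For this the operators are made to act on a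
concrete set (`act`), consisting of vectors, moved by reflections, and of ordered pairs of vectors
standing for B₂ subsystems. All defining relations hold there, and the value of 𝒫(v) is v or a pair
with first entry v (`eval_elt`). Hence 𝒫(v) is nonzero and determines v. Lengths are well defined
because relations between nonzero words keep the number of letters.

The formulas in (e) follow by adding simple coroots in the ε-coordinates; only the words [i,n,j-1]
in type C need relations of the monoid (`upDown_adjacent`). -/

namespace Zhelobenko

open Finset

/-! ### Coordinate vectors and axioms for the set of coroots -/

section CoordinateVectors

variable {I : Type*} [Fintype I] [DecidableEq I]

/-- The `i`-th unit vector, thought of as the coordinates of the simple coroot `α_i^∨`. -/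
def unit (i : I) : I → ℤ := Pi.single i 1

lemma unit_same (i : I) : unit i i = 1 := by simp [unit]

lemma unit_ne {i j : I} (h : j ≠ i) : unit i j = 0 := by simp [unit, h]

lemma unit_nonneg (i : I) : 0 ≤ unit i := by
  intro j
  by_cases h : j = i
  · subst h; simp [unit]
  · simp [unit, h]

lemma unit_injective : Function.Injective (unit : I → I → ℤ) := by
  intro i j h
  by_contra hij
  have := congrFun h i
  simp [unit, hij] at this

/-- The value of the simple root `α_i` on the vector with coordinates `v`. -/
def pair (C : Matrix I I ℤ) (i : I) (v : I → ℤ) : ℤ := ∑ j, C i j * v j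

variable (C : Matrix I I ℤ) (i j : I) (v w : I → ℤ) (z : ℤ)

@[simp] lemma pair_unit : pair C i (unit j) = C i j := by simp [pair, unit, Pi.single_apply]

@[simp] lemma pair_add : pair C i (v + w) = pair C i v + pair C i w := by
  simp [pair, mul_add, sum_add_distrib]

@[simp] lemma pair_neg : pair C i (-v) = -pair C i v := by simp [pair]

@[simp] lemma pair_sub : pair C i (v - w) = pair C i v - pair C i w := by
  simp [pair, mul_sub, sum_sub_distrib]

@[simp] lemma pair_smul : pair C i (z • v) = z * pair C i v := by
  simp [pair, mul_sum, mul_left_comm]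

/-- The simple reflection `s_i` in coordinates. -/
def refl (C : Matrix I I ℤ) (i : I) (v : I → ℤ) : I → ℤ := v - pair C i v • unit i

@[simp] lemma pair_refl : pair C i (refl C j v) = pair C i v - pair C j v * C i j := by
  rw [refl, pair_sub, pair_smul, pair_unit]

/-- The sum of the coordinates. -/
def ht (v : I → ℤ) : ℤ := ∑ i, v i

@[simp] lemma ht_unit : ht (unit i) = 1 := by simp [ht, unit]

@[simp] lemma ht_add : ht (v + w) = ht v + ht w := by simp [ht, sum_add_distrib]

@[simp] lemma ht_sub : ht (v - w) = ht v - ht w := by simp [ht, sum_sub_distrib]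

variable {v}

lemma ht_pos (hv : 0 ≤ v) (h0 : v ≠ 0) : 0 < ht v := by
  obtain ⟨k, hk⟩ := Function.ne_iff.mp h0
  exact sum_pos' (fun j _ ↦ hv j) ⟨k, mem_univ _, lt_of_le_of_ne (hv k) (Ne.symm hk)⟩

end CoordinateVectors

/-- The set `R` of coordinate vectors is the set of coroots of a crystallographic root system with
Cartan matrix `C` in which squared lengths, measured by `B`, take at most the values `2` and `4`
(the simple coroot `α_i^∨` has squared length `2 d_i`). -/
structure IsCorootSystem {I : Type*} [Fintype I] [DecidableEq I] (C : Matrix I I ℤ)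
    (R : Set (I → ℤ)) (d : I → ℤ) (B : LinearMap.BilinForm ℤ (I → ℤ)) : Prop where
  diag : ∀ i, C i i = 2
  len_simple : ∀ i, d i = 1 ∨ d i = 2
  symm : ∀ v w, B v w = B w v
  form_unit : ∀ i v, B (unit i) v = d i * pair C i v
  unit_mem : ∀ i, unit i ∈ R
  refl_mem : ∀ i, ∀ v ∈ R, refl C i v ∈ R
  nonneg_or : ∀ v ∈ R, 0 ≤ v ∨ v ≤ 0
  ne_zero : ∀ v ∈ R, v ≠ 0
  form_self : ∀ v ∈ R, B v v = 2 ∨ B v v = 4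
  sub_mem : ∀ v ∈ R, ∀ w ∈ R, v ≠ w → 0 < B v w → v - w ∈ R
  -- Strict Cauchy–Schwarz for `v` and `unit i`, divided by `d i`.
  pair_sq_lt : ∀ i, ∀ v ∈ R, v ≠ unit i → v ≠ -unit i → pair C i v ^ 2 * d i < 2 * B v v
  -- For `v` long, 2 B(v, w) / B(v, v) is an integer, so B(v, `unit i`) is even.
  pair_even : ∀ i, ∀ v ∈ R, B v v = 4 → d i = 1 → Even (pair C i v)
  exists_pair_pos : ∀ v ∈ R, 0 ≤ v → ∃ i, 0 < pair C i v

/-! ### Strings, lengths and descents of coroots -/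

namespace IsCorootSystem

variable {I : Type*} [Fintype I] [DecidableEq I] {C : Matrix I I ℤ} {R : Set (I → ℤ)} {d : I → ℤ}
  {B : LinearMap.BilinForm ℤ (I → ℤ)} (h : IsCorootSystem C R d B)
  {i j k : I} {v w : I → ℤ}

include h

lemma d_pos (i : I) : 0 < d i := by rcases h.len_simple i with hi | hi <;> omega

lemma form_unit_right (i : I) (v : I → ℤ) : B v (unit i) = d i * pair C i v := by
  rw [h.symm, h.form_unit]

lemma form_unit_unit (i j : I) : B (unit i) (unit j) = d i * C i j := by
  rw [h.form_unit, pair_unit]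

lemma d_mul_comm (i j : I) : d i * C i j = d j * C j i := by
  rw [← h.form_unit_unit, ← h.form_unit_unit, h.symm]

lemma form_add_unit (i : I) (v : I → ℤ) :
    B (v + unit i) (v + unit i) = B v v + 2 * d i * pair C i v + 2 * d i := by
  simp only [map_add, LinearMap.add_apply, h.form_unit, h.form_unit_right, pair_unit, h.diag]
  ring

lemma form_sub_unit (i : I) (v : I → ℤ) :
    B (v - unit i) (v - unit i) = B v v - 2 * d i * pair C i v + 2 * d i := by
  simp only [map_sub, LinearMap.sub_apply, h.form_unit, h.form_unit_right, pair_unit, h.diag]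
  ring

lemma form_refl (i : I) (v w : I → ℤ) : B (refl C i v) (refl C i w) = B v w := by
  simp only [refl, map_sub, LinearMap.sub_apply, map_smul, LinearMap.smul_apply, h.form_unit,
    h.form_unit_right, pair_unit, h.diag, smul_eq_mul]
  ring

lemma pair_refl_self (i : I) (v : I → ℤ) : pair C i (refl C i v) = -pair C i v := by
  rw [pair_refl, h.diag]; ring

lemma refl_refl (i : I) (v : I → ℤ) : refl C i (refl C i v) = v := by
  rw [refl, h.pair_refl_self, refl]; module

lemma refl_mem_iff (i : I) (v : I → ℤ) : refl C i v ∈ R ↔ v ∈ R :=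
  ⟨fun hv ↦ by simpa [h.refl_refl] using h.refl_mem i _ hv, h.refl_mem i v⟩

lemma refl_unit_self (i : I) : refl C i (unit i) = -unit i := by
  rw [refl, pair_unit, h.diag]; module

/-- The possible values of a simple root on a coroot. -/
lemma pair_cases (i : I) (hv : v ∈ R) (h1 : v ≠ unit i) (h2 : v ≠ -unit i) :
    (pair C i v = 0 ∨ pair C i v = 1 ∨ pair C i v = -1) ∨
      (pair C i v = 2 ∨ pair C i v = -2) ∧ B v v = 4 ∧ d i = 1 := by
  have key := h.pair_sq_lt i v hv h1 h2
  have ev := h.pair_even i v hv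
  set a := pair C i v
  rcases h.len_simple i with hd | hd <;> rcases h.form_self v hv with hl | hl <;>
    rw [hl, hd] at key
  · have : a < 2 := by nlinarith
    have : -2 < a := by nlinarith
    omega
  · have h3 : a < 3 := by nlinarith
    have h4 : -3 < a := by nlinarith
    obtain ⟨n, hn⟩ := ev hl hd
    omega
  · have : a < 2 := by nlinarith
    have : -2 < a := by nlinarith
    omega
  · have : a < 2 := by nlinarith
    have : -2 < a := by nlinarith
    omega

omit h in
lemma ne_neg_unit (hv0 : 0 ≤ v) (i : I) : v ≠ -unit i := by
  intro he
  have := hv0 i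
  rw [he] at this
  simp [unit_same] at this

lemma sub_unit_mem' (hv : v ∈ R) (h1 : v ≠ unit i) (hp : 0 < pair C i v) : v - unit i ∈ R :=
  h.sub_mem v hv _ (h.unit_mem i) h1 (by
    rw [h.form_unit_right]; exact mul_pos (h.d_pos i) hp)

/-- The reflection s_i turns adding `unit i` into subtracting it. -/
lemma add_unit_mem' (hv : v ∈ R) (h1 : v ≠ -unit i) (hp : pair C i v < 0) : v + unit i ∈ R := by
  rw [← h.refl_mem_iff i] at hv ⊢
  have e1 : refl C i (v + unit i) = refl C i v - unit i := by
    simp only [refl, pair_add, pair_unit, h.diag]; module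
  rw [e1]
  refine h.sub_unit_mem' hv ?_ (by rw [h.pair_refl_self]; omega)
  intro he
  apply h1
  rw [← h.refl_refl i v, he, h.refl_unit_self]

/-- Coordinates of a coroot have one sign and only the i-th one changes. If the difference were
nonpositive, `v` would be supported at i with coordinate 0 or 1. -/
lemma sub_unit_nonneg (hv : v ∈ R ∧ 0 ≤ v) (h1 : v ≠ unit i) (hm : v - unit i ∈ R) :
    v - unit i ∈ R ∧ 0 ≤ v - unit i := by
  refine ⟨hm, ?_⟩
  rcases h.nonneg_or _ hm with h2 | h2
  · exact h2
  exfalso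
  have hj : ∀ j, j ≠ i → v j = 0 := fun j hj ↦ by
    have a := h2 j
    have b := hv.2 j
    simp [unit_ne hj] at a b
    omega
  have hi : v i = 0 ∨ v i = 1 := by
    have a := h2 i
    have b := hv.2 i
    simp [unit_same] at a b
    omega
  rcases hi with hi | hi
  · apply h.ne_zero v hv.1
    ext j; by_cases hji : j = i
    · subst hji; exact hi
    · exact hj j hji
  · apply h1
    ext j; by_cases hji : j = i
    · subst hji; simp [hi, unit_same]
    · simp [hj j hji, unit_ne hji]

lemma unit_pos (i : I) : unit i ∈ R ∧ 0 ≤ unit i := ⟨h.unit_mem i, unit_nonneg i⟩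

lemma sub_unit_pos (hv : v ∈ R ∧ 0 ≤ v) (h1 : v ≠ unit i) (hp : 0 < pair C i v) :
    v - unit i ∈ R ∧ 0 ≤ v - unit i :=
  h.sub_unit_nonneg hv h1 (h.sub_unit_mem' hv.1 h1 hp)

lemma add_unit_nonneg (hv : v ∈ R ∧ 0 ≤ v) (hm : v + unit i ∈ R) :
    v + unit i ∈ R ∧ 0 ≤ v + unit i := ⟨hm, add_nonneg hv.2 (unit_nonneg i)⟩

lemma add_unit_pos (hv : v ∈ R ∧ 0 ≤ v) (hp : pair C i v < 0) :
    v + unit i ∈ R ∧ 0 ≤ v + unit i :=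
  h.add_unit_nonneg hv (h.add_unit_mem' hv.1 (ne_neg_unit hv.2 i) hp)

lemma one_le_ht (hv : v ∈ R ∧ 0 ≤ v) : 1 ≤ ht v := ht_pos hv.2 (h.ne_zero v hv.1)

lemma ne_of_pair (hp : pair C i v ≠ 2) : v ≠ unit i := by
  rintro rfl
  simp [h.diag] at hp

lemma unit_sub_unit_notMem (hij : i ≠ j) : unit i - unit j ∉ R := by
  intro hm
  rcases h.nonneg_or _ hm with h1 | h1
  · have := h1 j
    simp [unit_same, unit_ne hij.symm] at this
  · have := h1 i
    simp [unit_same, unit_ne hij] at this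

lemma cartan_nonpos (hij : i ≠ j) : C i j ≤ 0 := by
  by_contra! hp
  refine h.unit_sub_unit_notMem hij.symm (h.sub_unit_mem' (h.unit_mem j)
    (fun he ↦ hij (unit_injective he).symm) (by rwa [pair_unit]))

/-- The possible off-diagonal entries of the Cartan matrix. -/
lemma cartan_cases (hij : i ≠ j) :
    (C i j = 0 ∧ C j i = 0) ∨ (C i j = -1 ∧ C j i = -1 ∧ d i = d j) ∨
      (C i j = -2 ∧ C j i = -1 ∧ d i = 1 ∧ d j = 2) ∨
      (C i j = -1 ∧ C j i = -2 ∧ d i = 2 ∧ d j = 1) := by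
  have key : ∀ {i j : I}, i ≠ j → C i j = 0 ∨ C i j = -1 ∨ C i j = -2 ∧ d i = 1 ∧ d j = 2 := by
    intro i j hij
    have h1 := h.cartan_nonpos hij
    have h2 := h.pair_cases i (h.unit_mem j) (fun he ↦ hij (unit_injective he).symm)
      (ne_neg_unit (unit_nonneg j) i)
    rw [h.form_unit_unit, h.diag, pair_unit] at h2
    omega
  have h1 := key hij
  have h2 := key hij.symm
  have h3 := h.d_mul_comm i j
  rcases h.len_simple i with h4 | h4 <;> rcases h.len_simple j with h5 | h5 <;>
    rw [h4, h5] at h3 <;> omega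

lemma cartan_prod_zero (hm : C i j * C j i = 0) : i ≠ j ∧ C i j = 0 ∧ C j i = 0 := by
  have hij : i ≠ j := by rintro rfl; simp [h.diag] at hm
  refine ⟨hij, ?_⟩
  rcases h.cartan_cases hij with h1 | h1 | h1 | h1 <;> simp_all

lemma cartan_prod_one (hm : C i j * C j i = 1) : i ≠ j ∧ C i j = -1 ∧ C j i = -1 := by
  have hij : i ≠ j := by rintro rfl; simp [h.diag] at hm
  refine ⟨hij, ?_⟩
  rcases h.cartan_cases hij with h1 | h1 | h1 | h1 <;> simp_all

lemma cartan_prod_two (hm : C i j * C j i = 2) :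
    i ≠ j ∧ (C i j = -2 ∧ C j i = -1 ∨ C i j = -1 ∧ C j i = -2) := by
  have hij : i ≠ j := by rintro rfl; simp [h.diag] at hm
  refine ⟨hij, ?_⟩
  rcases h.cartan_cases hij with h1 | h1 | h1 | h1 <;> simp_all

lemma cartan_prod_ne_three : C i j * C j i ≠ 3 := by
  intro hm
  have hij : i ≠ j := by rintro rfl; simp [h.diag] at hm
  rcases h.cartan_cases hij with h1 | h1 | h1 | h1 <;> simp_all

/-- A coroot in the middle of a string of length three is short. -/
lemma middle (hv : v ∈ R) (h0 : pair C i v = 0) (hm : v + unit i ∈ R) :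
    B v v = 2 ∧ d i = 1 ∧ B (v + unit i) (v + unit i) = 4 ∧ v - unit i ∈ R := by
  have hp : pair C i (v + unit i) = 2 := by rw [pair_add, h0, pair_unit, h.diag]; rfl
  have h1 : v + unit i ≠ unit i := by
    intro he; exact h.ne_zero v hv (by simpa using he)
  have h2 : v + unit i ≠ -unit i := by
    intro he; rw [he, pair_neg, pair_unit, h.diag] at hp; omega
  have h3 := h.pair_cases i hm h1 h2
  have h4 := h.form_add_unit i v
  have h5 : v - unit i ∈ R := by
    have := h.refl_mem i _ hm
    rw [refl, hp] at this
    convert this using 1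
    module
  have h6 : B (v + unit i) (v + unit i) = 4 ∧ d i = 1 := by omega
  rw [h0, h6.1, h6.2] at h4
  exact ⟨by omega, h6.2, h6.1, h5⟩

/-- A coroot on which a simple root `α_i` takes the value two is `α_i^∨` or long. -/
lemma pair_two (hv : v ∈ R) (h1 : v ≠ unit i) (h2 : pair C i v = 2) :
    B v v = 4 ∧ d i = 1 ∧ B (v - unit i) (v - unit i) = 2 := by
  have h3 : v ≠ -unit i := by
    intro he; rw [he, pair_neg, pair_unit, h.diag] at h2; omega
  have h4 := h.pair_cases i hv h1 h3
  have h5 := h.form_sub_unit i v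
  have h6 : B v v = 4 ∧ d i = 1 := by omega
  rw [h2, h6.1, h6.2] at h5
  exact ⟨h6.1, h6.2, by omega⟩

lemma pair_le_two (hv : v ∈ R) : pair C i v ≤ 2 := by
  by_cases h1 : v = unit i
  · rw [h1, pair_unit, h.diag]
  by_cases h2 : v = -unit i
  · rw [h2, pair_neg, pair_unit, h.diag]; omega
  have := h.pair_cases i hv h1 h2
  omega

lemma neg_two_le_pair (hv : v ∈ R) : -2 ≤ pair C i v := by
  have := h.pair_le_two (i := i) (h.refl_mem i v hv)
  rw [h.pair_refl_self] at this
  omega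

/-- Values of α_i on coroots lie between -2 and 2, and adding `unit i` raises them by 2. -/
lemma pair_eq_zero_of_middle (h1 : v + unit i ∈ R) (h2 : v - unit i ∈ R) : pair C i v = 0 := by
  have h3 := h.pair_le_two (i := i) h1
  have h4 := h.neg_two_le_pair (i := i) h2
  simp only [pair_add, pair_sub, pair_unit, h.diag] at h3 h4
  omega

/-- The reflection s_i would send the sum to a difference of two simple coroots, which has mixed
signs. -/
lemma unit_add_unit_notMem (h0 : C i j = 0) : unit i + unit j ∉ R := by
  intro hm
  have hij : i ≠ j := by rintro rfl; simp [h.diag] at h0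
  have := h.refl_mem i _ hm
  rw [refl, pair_add, pair_unit, pair_unit, h0, h.diag] at this
  apply h.unit_sub_unit_notMem hij.symm
  convert this using 1
  module

/-- Two descents of a positive coroot are orthogonal, or the coroot is the sum of two simple ones
of the same length. -/
lemma two_descents (hv : v ∈ R ∧ 0 ≤ v) (hij : i ≠ j) (hi : v ≠ unit i) (hj : v ≠ unit j)
    (hpi : 0 < pair C i v) (hpj : 0 < pair C j v) :
    (C i j = 0 ∧ C j i = 0 ∧ v - unit i ≠ unit j) ∨
      (C i j = -1 ∧ C j i = -1 ∧ v = unit i + unit j) := by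
  have hvi := h.sub_unit_pos hv hi hpi
  have hvj := h.sub_unit_pos hv hj hpj
  -- These bounds rule out double bonds: if `C j i = -2`, the first one says α_j(v) ≤ 0, and
  -- symmetrically for `C i j`.
  have ci := h.pair_le_two (i := j) hvi.1
  have cj := h.pair_le_two (i := i) hvj.1
  rw [pair_sub, pair_unit] at ci cj
  rcases h.cartan_cases hij with h1 | h1 | h1 | h1
  · left
    refine ⟨h1.1, h1.2, fun he ↦ h.unit_add_unit_notMem h1.1 ?_⟩
    rw [← he]; simpa using hv.1
  · right
    refine ⟨h1.1, h1.2.1, ?_⟩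
    by_contra hne
    -- If v is not the sum, v - α_i^∨ takes the value 2 under α_j, so it is long and the simple
    -- coroots are short. Then v is long too, and its odd pairing with α_i contradicts `pair_even`.
    have hi1 : pair C i v = 1 := by omega
    have hj1 : pair C j v = 1 := by omega
    have e1 : v - unit i ≠ unit j := fun he ↦ hne (by rw [← he]; abel)
    have h2 := h.pair_two hvi.1 e1 (by rw [pair_sub, pair_unit]; omega)
    have h3 := h.form_sub_unit i v
    have h4 := h.pair_even i v hv.1
    rw [hi1] at h3 h4
    have h5 := h4 (by omega) (by omega)
    exact absurd h5 (by decide)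
  · exfalso
    have e1 : v - unit j ≠ unit i := by
      intro he
      have : v = unit i + unit j := by rw [← he]; abel
      rw [this, pair_add, pair_unit, pair_unit, h.diag] at hpi
      omega
    have h2 := h.pair_two hvj.1 e1 (by rw [pair_sub, pair_unit]; omega)
    have e2 : v - unit i ≠ unit j := by
      intro he
      have : v = unit i + unit j := by rw [← he]; abel
      rw [this, pair_add, pair_unit, pair_unit, h.diag] at hpi
      omega
    have h3 := h.pair_two hvi.1 e2 (by rw [pair_sub, pair_unit]; omega)
    omega
  · exfalso
    have e1 : v - unit j ≠ unit i := by
      intro he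
      have : v = unit i + unit j := by rw [← he]; abel
      rw [this, pair_add, pair_unit, pair_unit, h.diag] at hpj
      omega
    have h2 := h.pair_two hvj.1 e1 (by rw [pair_sub, pair_unit]; omega)
    omega

end IsCorootSystem
end Zhelobenko

/-! ### Construction of 𝒫: relations, lengths and independence of the path -/

namespace Zhelobenko

section Relations

variable {I : Type*} {C : Matrix I I ℤ} {i j k : I}

/-- The generator `P_k`. -/
def gen (C : Matrix I I ℤ) (k : I) : PointedMonoid C := word C [] k

@[simp] lemma op_zero (i : I) : op i (0 : PointedMonoid C) = 0 := rfl

lemma word_cons (i : I) (u : List I) (k : I) : word C (i :: u) k = op i (word C u k) := rfl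

lemma op_gen_self (i : I) : op i (gen C i) = 0 := Quot.sound (Step.kill [] i)

lemma op_gen_of_orth (h : C i j * C j i = 0) : op i (gen C j) = 0 := Quot.sound (Step.orth [] i j h)

lemma op_gen_swap (h : C i j * C j i = 1) : op i (gen C j) = op j (gen C i) :=
  Quot.sound (Step.swap₁ [] i j h)

lemma op_op_gen_swap (h : C i j * C j i = 2) : op j (op i (gen C j)) = op i (op j (gen C i)) :=
  Quot.sound (Step.swap₂ [] i j h)

lemma op_op_self (i : I) (x : PointedMonoid C) : op i (op i x) = 0 := by
  induction x using Quot.ind with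
  | mk x => rcases x with - | ⟨v, k⟩
            · rfl
            · exact Quot.sound (Step.sq [] v i k)

lemma op_comm (h : C i j * C j i = 0) (x : PointedMonoid C) : op i (op j x) = op j (op i x) := by
  induction x using Quot.ind with
  | mk x => rcases x with - | ⟨v, k⟩
            · rfl
            · exact Quot.sound (Step.comm [] v i j k h)

lemma op_braid₁ (h : C i j * C j i = 1) (x : PointedMonoid C) :
    op i (op j (op i x)) = op j (op i (op j x)) := by
  induction x using Quot.ind with
  | mk x => rcases x with - | ⟨v, k⟩
            · rfl
            · exact Quot.sound (Step.braid₁ [] v i j k h)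

lemma op_braid₂ (h : C i j * C j i = 2) (x : PointedMonoid C) :
    op i (op j (op i (op j x))) = op j (op i (op j (op i x))) := by
  induction x using Quot.ind with
  | mk x => rcases x with - | ⟨v, k⟩
            · rfl
            · exact Quot.sound (Step.braid₂ [] v i j k h)

end Relations

section Length

variable {I : Type*} {C : Matrix I I ℤ}

/-- Keep an element if it is given by a word with `n` operators, and replace it by zero
otherwise. -/
def lengthPart (C : Matrix I I ℤ) (n : ℕ) : PointedMonoid C → PointedMonoid C :=
  Quot.lift (fun x ↦ x.elim 0 fun w ↦ if w.1.length = n then word C w.1 w.2 else 0) (by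
    intro x y hxy
    -- A relation with right side 0 is respected because its word is already 0; every other relation
    -- preserves the number of letters.
    have key := Quot.sound hxy
    cases hxy with
    | sq u v i k => exact ite_eq_right_iff.mpr fun _ ↦ key
    | kill u i => exact ite_eq_right_iff.mpr fun _ ↦ key
    | orth u i j h => exact ite_eq_right_iff.mpr fun _ ↦ key
    | _ => exact if_congr (by simp) key rfl)

lemma length_eq_of_word_eq {u u' : List I} {k k' : I} (h : word C u k = word C u' k')
    (h0 : word C u k ≠ 0) : u.length = u'.length := by
  by_contra hne
  have := congrArg (lengthPart C u.length) h
  change (if u.length = u.length then word C u k else 0) =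
    (if u'.length = u.length then word C u' k' else 0) at this
  rw [if_pos rfl, if_neg (Ne.symm hne)] at this
  exact h0 this

end Length

variable {I : Type*} [Fintype I] [DecidableEq I]

/-- The elements obtained from `P_i` by adding simple coroots, going from the bottom or the middle
of a root string to its top. -/
inductive Path (C : Matrix I I ℤ) (R : Set (I → ℤ)) : (I → ℤ) → PointedMonoid C → Prop
  | gen (i : I) : Path C R (unit i) (gen C i)
  | step (i : I) (v : I → ℤ) (x : PointedMonoid C) : Path C R v x → v ∈ R ∧ 0 ≤ v →
      v + unit i ∈ R → 0 < pair C i (v + unit i) → Path C R (v + unit i) (op i x)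

namespace IsCorootSystem

variable {C : Matrix I I ℤ} {R : Set (I → ℤ)} {d : I → ℤ}
  {B : LinearMap.BilinForm ℤ (I → ℤ)} (h : IsCorootSystem C R d B)
  {i j k : I} {v w : I → ℤ}

include h

lemma exists_path (n : ℕ) (v : I → ℤ) (hv : v ∈ R ∧ 0 ≤ v) (hn : ht v = n) :
    ∃ x, Path C R v x := by
  induction n generalizing v with
  | zero => have := h.one_le_ht hv; omega
  | succ n ih =>
    obtain ⟨i, hi⟩ := h.exists_pair_pos v hv.1 hv.2
    by_cases hvi : v = unit i
    · exact ⟨_, hvi ▸ Path.gen i⟩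
    have hw := h.sub_unit_pos hv hvi hi
    obtain ⟨x, hx⟩ := ih (v - unit i) hw
      (by rw [ht_sub, ht_unit, hn]; push_cast; ring)
    refine ⟨op i x, ?_⟩
    have := Path.step i _ _ hx hw
    rw [sub_add_cancel] at this
    exact this hv.1 hi

lemma path_cases {x : PointedMonoid C} (hx : Path C R v x) :
    (∃ i, v = unit i ∧ x = gen C i) ∨
      ∃ i y, Path C R (v - unit i) y ∧ x = op i y ∧ v ≠ unit i ∧ 0 < pair C i v ∧
        (v ∈ R ∧ 0 ≤ v) := by
  cases hx with
  | gen i => exact Or.inl ⟨i, rfl, rfl⟩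
  | step i w y hw hwR hv hp =>
    refine Or.inr ⟨i, y, by simpa using hw, rfl, fun he ↦ h.ne_zero w hwR.1 (by simpa using he), hp,
      h.add_unit_nonneg hwR hv⟩

/-- An ascent along j ends where α_j is positive, but α_j ≤ 0 on every other simple coroot. -/
lemma path_unit {x : PointedMonoid C} (hx : Path C R (unit i) x) : x = gen C i := by
  rcases h.path_cases hx with ⟨j, hj, rfl⟩ | ⟨j, y, -, -, hj, hp, hv⟩
  · rw [unit_injective hj]
  · exfalso
    rw [pair_unit] at hp
    have := h.cartan_nonpos (i := j) (j := i) (fun he ↦ hj (by rw [he]))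
    omega

lemma path_unique : ∀ (n : ℕ) (v : I → ℤ) (x y : PointedMonoid C), ht v = n →
    Path C R v x → Path C R v y → x = y := by
  intro n
  induction n using Nat.strong_induction_on with
  | _ n ih =>
  intro v x y hn hx hy
  rcases h.path_cases hx with ⟨i, rfl, rfl⟩ | ⟨i, x', hx', rfl, hi, hpi, hv⟩
  · exact (h.path_unit hy).symm
  rcases h.path_cases hy with ⟨j, rfl, rfl⟩ | ⟨j, y', hy', rfl, hj, hpj, -⟩
  · exact h.path_unit hx
  have hvi := h.sub_unit_pos hv hi hpi
  have hvj := h.sub_unit_pos hv hj hpj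
  have e1 := h.one_le_ht hvi
  have hti : ht (v - unit i) = ((n - 1 : ℕ) : ℤ) := by
    rw [ht_sub, ht_unit] at e1 ⊢; omega
  have htj : ht (v - unit j) = ((n - 1 : ℕ) : ℤ) := by
    rw [ht_sub, ht_unit] at e1 ⊢; omega
  have hn0 : n - 1 < n := by rw [ht_sub, ht_unit] at e1; omega
  by_cases hij : i = j
  · subst hij
    rw [ih _ hn0 _ _ _ hti hx' hy']
  rcases h.two_descents hv hij hi hj hpi hpj with ⟨c1, c2, hne⟩ | ⟨c1, c2, rfl⟩
  -- Orthogonal descents have the common lower coroot v - α_i^∨ - α_j^∨, and the induction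
  -- hypothesis lets both paths be rerouted through it.
  · have hpj' : 0 < pair C j (v - unit i) := by rw [pair_sub, pair_unit, c2]; omega
    have hpi' : 0 < pair C i (v - unit j) := by rw [pair_sub, pair_unit, c1]; omega
    have hw := h.sub_unit_pos hvi hne hpj'
    obtain ⟨z, hz⟩ := h.exists_path _ _ hw (Int.toNat_of_nonneg (by
      have := h.one_le_ht hw; omega)).symm
    have p1 : Path C R (v - unit i) (op j z) := by
      have := Path.step j _ _ hz hw
      rw [sub_add_cancel] at this
      exact this hvi.1 hpj'
    have p2 : Path C R (v - unit j) (op i z) := by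
      have hc : v - unit i - unit j = v - unit j - unit i := by abel
      rw [hc] at hz hw
      have := Path.step i _ _ hz hw
      rw [sub_add_cancel] at this
      exact this hvj.1 hpi'
    rw [ih _ hn0 _ _ _ hti hx' p1, ih _ hn0 _ _ _ htj hy' p2]
    exact op_comm (by rw [c1]; simp) z
  · rw [add_sub_cancel_left] at hx'
    rw [add_sub_cancel_right] at hy'
    rw [h.path_unit hx', h.path_unit hy']
    exact op_gen_swap (by rw [c1, c2]; norm_num)

end IsCorootSystem

open Classical in
/-- The map `𝒫`, on coordinates of positive coroots. -/
noncomputable def elt (C : Matrix I I ℤ) (R : Set (I → ℤ)) (v : I → ℤ) : PointedMonoid C :=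
  if h : ∃ x, Path C R v x then h.choose else 0

namespace IsCorootSystem

variable {C : Matrix I I ℤ} {R : Set (I → ℤ)} {d : I → ℤ}
  {B : LinearMap.BilinForm ℤ (I → ℤ)} (h : IsCorootSystem C R d B)
  {i j k : I} {v w : I → ℤ}

include h

lemma path_elt (hv : v ∈ R ∧ 0 ≤ v) : Path C R v (elt C R v) := by
  have : ∃ x, Path C R v x := h.exists_path (ht v).toNat v hv (by
    have := h.one_le_ht hv; omega)
  rw [elt, dif_pos this]
  exact this.choose_spec

lemma elt_eq {x : PointedMonoid C} (hv : v ∈ R ∧ 0 ≤ v) (hx : Path C R v x) : elt C R v = x :=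
  h.path_unique (ht v).toNat v _ _ (by have := h.one_le_ht hv; omega) (h.path_elt hv) hx

lemma elt_unit (i : I) : elt C R (unit i) = gen C i := h.elt_eq (h.unit_pos i) (.gen i)

/-- The bound on the pairing makes α_i positive on the sum, as an ascent in `Path` requires. From
pairing -2 the sum is the middle of its string, and this ascent is not allowed. -/
lemma elt_add (hv : v ∈ R ∧ 0 ≤ v) (hm : v + unit i ∈ R) (hp : -1 ≤ pair C i v) :
    elt C R (v + unit i) = op i (elt C R v) :=
  h.elt_eq (h.add_unit_nonneg hv hm) (.step i v _ (h.path_elt hv) hv hm (by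
    rw [pair_add, pair_unit, h.diag]; omega))

lemma elt_sub (hv : v ∈ R ∧ 0 ≤ v) (h1 : v ≠ unit i) (hp : 0 < pair C i v) :
    elt C R v = op i (elt C R (v - unit i)) := by
  have := h.elt_add (h.sub_unit_pos hv h1 hp) (i := i) (by simpa using hv.1) (by
    rw [pair_sub, pair_unit, h.diag]; omega)
  simpa using this

/-- The coroot descends along i, so A_i is applied twice in a row, or it is α_i^∨ itself. -/
lemma op_elt_of_pair_pos (hv : v ∈ R ∧ 0 ≤ v) (hp : 0 < pair C i v) : op i (elt C R v) = 0 := by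
  by_cases h1 : v = unit i
  · rw [h1, h.elt_unit, op_gen_self]
  · rw [h.elt_sub hv h1 hp, op_op_self]

lemma exists_word (hv : v ∈ R ∧ 0 ≤ v) :
    ∃ u k, elt C R v = word C u k ∧ (u.length : ℤ) + 1 = ht v := by
  have hp := h.path_elt hv
  generalize elt C R v = x at hp
  induction hp with
  | gen i => exact ⟨[], i, rfl, by simp⟩
  | step i v x _ hv' _ _ ih =>
    obtain ⟨u, k, rfl, hu⟩ := ih hv'
    exact ⟨i :: u, k, rfl, by simp [← hu]⟩

end IsCorootSystem
end Zhelobenko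

/-! ### Vanishing of A_i on coroots with trivial α_i-string -/

namespace Zhelobenko
namespace IsCorootSystem

variable {I : Type*} [Fintype I] [DecidableEq I] {C : Matrix I I ℤ} {R : Set (I → ℤ)} {d : I → ℤ}
  {B : LinearMap.BilinForm ℤ (I → ℤ)} (h : IsCorootSystem C R d B)
  {i j k : I} {v w : I → ℤ}

include h

/-- The case of a short coroot orthogonal to adjacent simple coroots `α_i^∨` short and `α_j^∨` long,
such that its sum with `α_i^∨` is a coroot. -/
lemma op_op_op_elt_eq_zero (hCij : C i j = -2) (n : ℕ) :
    ∀ v : I → ℤ, ht v = n → v ∈ R ∧ 0 ≤ v → pair C i v = 0 → pair C j v = 0 → v + unit i ∈ R →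
      op i (op j (op i (elt C R v))) = 0 := by
  have hij : i ≠ j := by rintro rfl; rw [h.diag] at hCij; omega
  have hCji : C j i = -1 ∧ d i = 1 ∧ d j = 2 := by
    rcases h.cartan_cases hij with h1 | h1 | h1 | h1 <;> omega
  obtain ⟨hCji, hdi, hdj⟩ := hCji
  have m2 : C i j * C j i = 2 := by rw [hCij, hCji]; norm_num
  have m2' : C j i * C i j = 2 := by rw [hCij, hCji]; norm_num
  induction n using Nat.strong_induction_on with
  | _ n ih =>
  intro v hn hv hi hj hm
  obtain ⟨hlen, -, -, hm'⟩ := h.middle hv.1 hi hm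
  obtain ⟨k, hk⟩ := h.exists_pair_pos v hv.1 hv.2
  have hki : k ≠ i := by rintro rfl; omega
  have hkj : k ≠ j := by rintro rfl; omega
  have hvk : v ≠ unit k := by
    rintro rfl
    exact h.unit_sub_unit_notMem hki hm'
  -- The value 2 would force `v` to be long, whereas `middle` shows it to be short.
  have hk1 : pair C k v = 1 := by
    have := h.pair_cases k hv.1 hvk (ne_neg_unit hv.2 k)
    omega
  have hv1 := h.sub_unit_pos hv hvk hk
  have ht1 := h.one_le_ht hv1
  have l1 : B (v - unit k) (v - unit k) = 2 := by rw [h.form_sub_unit, hk1, hlen]; ring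
  rw [h.elt_sub hv hvk hk]
  rcases h.cartan_cases hki with ⟨cki, cik⟩ | hcki
  · rcases h.cartan_cases hkj with ⟨ckj, cjk⟩ | hckj
    · -- `k` is orthogonal to `i` and `j`
      have mk : C i k * C k i = 0 := by rw [cki]; simp
      have mk' : C j k * C k j = 0 := by rw [ckj]; simp
      rw [op_comm mk, op_comm mk', op_comm mk]
      rw [ih (n - 1) (by rw [ht_sub, ht_unit] at ht1; omega) (v - unit k)
        (by rw [ht_sub, ht_unit] at ht1 ⊢; omega) hv1 (by rw [pair_sub, pair_unit, hi, cik]; rfl)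
        (by rw [pair_sub, pair_unit, hj, cjk]; rfl), op_zero]
      have h2 : v + unit i - unit k ∈ R := by
        refine h.sub_unit_mem' hm (h.ne_of_pair ?_) ?_ <;> rw [pair_add, pair_unit, hk1, cki] <;>
          norm_num
      convert h2 using 1
      abel
    · -- `k` is orthogonal to `i` but not to `j`
      have cjk : C j k = -1 := by omega
      have p1 : pair C j (v - unit k) = 1 := by rw [pair_sub, pair_unit, hj, cjk]; rfl
      have n1 : v - unit k ≠ unit j := h.ne_of_pair (by omega)
      have hv2 := h.sub_unit_pos hv1 n1 (by omega)
      have p2 : pair C i (v - unit k - unit j) = 2 := by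
        rw [pair_sub, pair_sub, pair_unit, pair_unit, hi, cik, hCij]; rfl
      have l2 : B (v - unit k - unit j) (v - unit k - unit j) = 2 := by
        rw [h.form_sub_unit, p1, l1]; ring
      -- A short coroot on which α_i takes the value 2 can only be α_i^∨.
      have e2 : v - unit k - unit j = unit i := by
        by_contra hne
        have := h.pair_two hv2.1 hne p2
        omega
      have ev : v = unit i + unit j + unit k := by rw [← e2]; abel
      have ckj : C k j = -1 := by
        rw [ev, pair_add, pair_add, pair_unit, pair_unit, pair_unit, h.diag, cki] at hk1
        omega
      have mik : C i k * C k i = 0 := by rw [cki]; simp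
      have mjk : C j k * C k j = 1 := by rw [ckj, cjk]; norm_num
      have mki : C k i * C i k = 0 := by rw [cki]; simp
      have mkj : C k j * C j k = 1 := by rw [ckj, cjk]; norm_num
      -- The word A_iA_jA_iA_kA_jP_i is turned into A_kA_jA_iA_jA_iP_k, which vanishes by A_iP_k =
      -- 0.
      rw [h.elt_sub hv1 n1 (by omega), e2, h.elt_unit, op_comm mik, op_op_gen_swap m2',
        op_braid₁ mjk, op_comm mki (gen C j), op_gen_swap mkj, op_comm mik, op_braid₂ m2,
        op_gen_of_orth mik]
      simp
  · -- `k` is adjacent to `i`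
    have cik : C i k = -1 := by
      rcases h.cartan_cases hki.symm with h1 | h1 | h1 | h1
      · omega
      · omega
      · exfalso
        have p1 : pair C i (v - unit k) = 2 := by rw [pair_sub, pair_unit, hi, h1.1]; rfl
        have e1 : v - unit k = unit i := by
          by_contra hne
          have := h.pair_two hv1.1 hne p1
          omega
        have ev : v = unit i + unit k := by rw [← e1]; abel
        rw [ev, pair_add, pair_unit, pair_unit, hCji] at hj
        have := h.cartan_nonpos hkj.symm
        omega
      · omega
    have p1 : pair C i (v - unit k) = 1 := by rw [pair_sub, pair_unit, hi, cik]; rfl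
    have n1 : v - unit k ≠ unit i := h.ne_of_pair (by omega)
    have hv2 := h.sub_unit_pos hv1 n1 (by omega)
    have l2 : B (v - unit k - unit i) (v - unit k - unit i) = 2 := by
      rw [h.form_sub_unit, p1, l1]; ring
    have n2 : v - unit k - unit i ≠ unit j := by
      intro he; rw [he, h.form_unit_unit, h.diag] at l2; omega
    have cjk : C j k = 0 := by
      have h1 := h.pair_cases j hv2.1 n2 (ne_neg_unit hv2.2 j)
      have h2 := h.cartan_nonpos hkj.symm
      rw [pair_sub, pair_sub, pair_unit, pair_unit, hj, hCji] at h1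
      omega
    have ckj : C k j = 0 := by
      rcases h.cartan_cases hkj with h1 | h1 | h1 | h1 <;> omega
    have p2 : pair C j (v - unit k - unit i) = 1 := by
      rw [pair_sub, pair_sub, pair_unit, pair_unit, hj, hCji, cjk]; rfl
    have hv3 := h.sub_unit_pos hv2 n2 (by omega)
    have l3 : B (v - unit k - unit i - unit j) (v - unit k - unit i - unit j) = 2 := by
      rw [h.form_sub_unit, p2, l2]; ring
    have p3 : pair C i (v - unit k - unit i - unit j) = 1 := by
      rw [pair_sub, pair_sub, p1, pair_unit, pair_unit, hCij, h.diag]; rfl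
    have n3 : v - unit k - unit i - unit j ≠ unit i := h.ne_of_pair (by omega)
    have hv4 := h.sub_unit_pos hv3 n3 (by omega)
    have l4 : B (v - unit k - unit i - unit j - unit i) (v - unit k - unit i - unit j - unit i)
        = 2 := by
      rw [h.form_sub_unit, p3, l3]; ring
    have p4 : pair C k (v - unit k - unit i - unit j - unit i) = -1 - 2 * C k i := by
      simp only [pair_sub, pair_unit, hk1, h.diag, ckj]; ring
    have n4 : v - unit k - unit i - unit j - unit i ≠ unit k := h.ne_of_pair (by omega)
    have cki : C k i = -1 := by
      have h1 := h.pair_cases k hv4.1 n4 (ne_neg_unit hv4.2 k)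
      omega
    have p4' : pair C k (v - unit k - unit i - unit j - unit i) = 1 := by rw [p4, cki]; rfl
    have hv5 := h.sub_unit_pos hv4 n4 (by omega)
    -- Descending along k, i, j, i, k leads to a coroot with all the properties assumed of `v`.
    set u := v - unit k - unit i - unit j - unit i - unit k with hu
    have hui : pair C i u = 0 := by
      simp only [hu, pair_sub, pair_unit, hi, h.diag, hCij, cik]; ring
    have huj : pair C j u = 0 := by
      simp only [hu, pair_sub, pair_unit, hj, h.diag, hCji, cjk]; ring
    have hum : u + unit i ∈ R := by
      have h1 := h.refl_mem k _ (h.refl_mem i _ (h.refl_mem j _ (h.refl_mem i _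
        (h.refl_mem k _ hm))))
      convert h1 using 1
      simp only [refl, hu, pair_sub, pair_add, pair_smul, pair_unit, hi, hj, hk1, h.diag, hCij,
        hCji, cik, cki, cjk, ckj]
      module
    have hul := h.one_le_ht hv5
    have hIH := ih (n - 5) (by simp only [hu, ht_sub, ht_unit] at hul; omega) u
      (by simp only [hu, ht_sub, ht_unit] at hul ⊢; omega) hv5 hui huj hum
    have mik : C i k * C k i = 1 := by rw [cik, cki]; norm_num
    have mki : C k i * C i k = 1 := by rw [cik, cki]; norm_num
    have mjk : C j k * C k j = 0 := by rw [cjk]; simp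
    have mkj : C k j * C j k = 0 := by rw [cjk]; simp
    rw [h.elt_sub hv1 n1 (by omega), h.elt_sub hv2 n2 (by omega), h.elt_sub hv3 n3 (by omega),
      h.elt_sub hv4 n4 (by omega)]
    -- The word A_iA_jA_i · A_kA_iA_jA_iA_k x is rewritten as A_kA_iA_jA_iA_k · A_iA_jA_i x, where
    -- the induction hypothesis applies.
    set x := elt C R u
    rw [op_braid₁ mik (op j (op i (op k x))), op_comm mjk (op i (op k (op j (op i (op k x))))),
      op_comm mkj (op i (op k x)), op_braid₁ mki x, op_braid₂ m2' (op k (op i x)),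
      op_comm mjk (op i x), op_braid₁ mik (op j (op i (op k (op j (op i x))))),
      op_comm mkj (op i (op k (op j (op i x)))), op_braid₁ mki (op j (op i x)), hIH]
    simp

/-- Induction on the height: 𝒫(v) begins with A_j for a descent j, unless v is simple, and the
relation between A_i and A_j brings a vanishing product to the right. -/
lemma op_elt_of_middle_aux (n : ℕ) :
    ∀ (v : I → ℤ) (i : I), ht v = n → v ∈ R ∧ 0 ≤ v → pair C i v = 0 → v + unit i ∉ R →
      op i (elt C R v) = 0 := by
  induction n using Nat.strong_induction_on with
  | _ n ih =>
  intro v i hn hv hi hm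
  obtain ⟨j, hj⟩ := h.exists_pair_pos v hv.1 hv.2
  have hij : i ≠ j := by rintro rfl; omega
  by_cases hvj : v = unit j
  · rw [hvj, pair_unit] at hi
    rw [hvj, h.elt_unit, op_gen_of_orth (by rw [hi]; simp)]
  have hj2 := h.pair_le_two (i := j) hv.1
  have hv1 := h.sub_unit_pos hv hvj hj
  have hl1 := h.one_le_ht hv1
  have hIH : ∀ w, ht w < ht v → w ∈ R ∧ 0 ≤ w → ∀ k, pair C k w = 0 → w + unit k ∉ R →
      op k (elt C R w) = 0 := by
    intro w hw hw' k
    have := h.one_le_ht hw'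
    exact ih (ht w).toNat (by omega) w k (by omega) hw'
  rw [h.elt_sub hv hvj hj]
  have hpj : pair C j (v - unit j) = pair C j v - 2 := by rw [pair_sub, pair_unit, h.diag]
  rcases h.cartan_cases hij with ⟨c1, c2⟩ | ⟨c1, c2, hd⟩ | ⟨c1, c2, hdi, hdj⟩ | ⟨c1, c2, hdi, hdj⟩
  · have hp1 : pair C i (v - unit j) = 0 := by rw [pair_sub, pair_unit, hi, c1]; rfl
    rw [op_comm (by rw [c1]; simp), hIH _ (by rw [ht_sub, ht_unit]; omega) hv1 i hp1, op_zero]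
    intro hmem
    by_cases hj1 : pair C j v = 1
    · apply hm
      have := h.add_unit_pos (h.add_unit_nonneg hv1 hmem) (i := j)
        (by rw [pair_add, pair_unit, hpj, c2]; omega)
      convert this.1 using 1
      abel
    -- Now v - α_j^∨ would be the middle of both its strings. The coroots v - α_j^∨ + α_i^∨ and v -
    -- 2α_j^∨ have inner product 2, so their difference α_i^∨ + α_j^∨ would be a coroot.
    · have hj0 : pair C j (v - unit j) = 0 := by omega
      have a1 := h.middle hv1.1 hp1 hmem
      have a2 := h.middle (i := j) hv1.1 hj0 (by simpa using hv.1)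
      apply h.unit_add_unit_notMem c1
      have hne : v - unit j + unit i ≠ v - unit j - unit j := by
        intro he
        have : unit i = -unit j := by
          have h0 := sub_eq_zero.mpr he
          have : unit i + unit j = 0 := by rw [← h0]; abel
          exact eq_neg_of_add_eq_zero_left this
        exact ne_neg_unit (unit_nonneg i) j this
      have := h.sub_mem _ hmem _ a2.2.2.2 hne (by
        have e1 : B (v - unit j + unit i) (v - unit j - unit j) =
            B (v - unit j) (v - unit j) - d j * pair C j (v - unit j) +
              d i * pair C i (v - unit j) - d i * C i j := by
          rw [map_add, LinearMap.add_apply, map_sub (B (v - unit j)), map_sub (B (unit i)),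
            h.form_unit_right, h.form_unit, h.form_unit, pair_unit]
          ring
        rw [e1, a1.1, hj0, hp1, c1]
        norm_num)
      convert this using 1
      abel
  · have hp1 : pair C i (v - unit j) = 1 := by rw [pair_sub, pair_unit, hi, c1]; rfl
    have n1 : v - unit j ≠ unit i := h.ne_of_pair (by omega)
    have hv2 := h.sub_unit_pos hv1 n1 (by omega)
    have hl2 := h.one_le_ht hv2
    have m1 : C i j * C j i = 1 := by rw [c1, c2]; norm_num
    have hp2 : pair C j (v - unit j - unit i) = pair C j v - 1 := by
      rw [pair_sub, hpj, pair_unit, c2]; ring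
    rw [h.elt_sub hv1 n1 (by omega), op_braid₁ m1]
    -- After the braid relation A_j meets 𝒫(v - α_j^∨ - α_i^∨). Its pairing with α_j is 0 or 1; in
    -- the first case induction applies since s_i maps v - α_i^∨ to v + α_i^∨.
    by_cases hj1 : pair C j v = 1
    · rw [hIH _ (by simp only [ht_sub, ht_unit]; omega) hv2 j (by omega)]
      · simp
      intro hmem
      apply hm
      have := h.refl_mem i _ hmem
      convert this using 1
      simp only [refl, pair_sub, pair_add, pair_unit, h.diag, hi, c1]
      module
    · rw [h.op_elt_of_pair_pos hv2 (by omega)]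
      simp
  · have hp1 : pair C i (v - unit j) = 2 := by rw [pair_sub, pair_unit, hi, c1]; rfl
    have n1 : v - unit j ≠ unit i := by
      intro he
      have ev : v = unit i + unit j := by rw [← he]; abel
      apply hm
      have := h.refl_mem i _ (h.unit_mem j)
      rw [refl, pair_unit, c1] at this
      convert this using 1
      rw [ev]; module
    have hv2 := h.sub_unit_pos hv1 n1 (by omega)
    have hj1 : pair C j v = 1 := by
      by_contra hne
      have := h.pair_two hv.1 hvj (by omega)
      omega
    rw [h.elt_sub hv1 n1 (by omega)]
    have hl2 := h.one_le_ht hv2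
    refine h.op_op_op_elt_eq_zero c1 (ht (v - unit j - unit i)).toNat _ (by omega) hv2 ?_ ?_ ?_
    · rw [pair_sub, hp1, pair_unit, h.diag]; rfl
    · rw [pair_sub, hpj, pair_unit, hj1, c2]; rfl
    · simpa using hv1.1
  · have m2 : C i j * C j i = 2 := by rw [c1, c2]; norm_num
    have hp1 : pair C i (v - unit j) = 1 := by rw [pair_sub, pair_unit, hi, c1]; rfl
    have n1 : v - unit j ≠ unit i := h.ne_of_pair (by omega)
    have hv2 := h.sub_unit_pos hv1 n1 (by omega)
    have hl2 := h.one_le_ht hv2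
    have hp2 : pair C j (v - unit j - unit i) = pair C j v := by
      rw [pair_sub, hpj, pair_unit, c2]; ring
    rw [h.elt_sub hv1 n1 (by omega)]
    by_cases n2 : v - unit j - unit i = unit j
    · rw [n2, h.elt_unit, op_op_gen_swap m2, op_op_self]
    · have hv3 := h.sub_unit_pos hv2 n2 (by omega)
      rw [h.elt_sub hv2 n2 (by omega), op_braid₂ m2,
        hIH _ (by simp only [ht_sub, ht_unit]; omega) hv3 i]
      · simp
      · rw [pair_sub, pair_sub, hp1, pair_unit, pair_unit, h.diag, c1]; rfl
      -- A string with a middle needs α_i^∨ short, but here `d i = 2`.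
      · intro hmem
        have := h.middle hv3.1 (by
          rw [pair_sub, pair_sub, hp1, pair_unit, pair_unit, h.diag, c1]; rfl) hmem
        omega

/-- A simple reflection operator kills a coroot whose string in the direction of the simple coroot
is trivial. -/
lemma op_elt_eq_zero (hv : v ∈ R ∧ 0 ≤ v) (h1 : v + unit i ∉ R) :
    op i (elt C R v) = 0 := by
  rcases lt_trichotomy (pair C i v) 0 with hp | hp | hp
  · exact absurd (h.add_unit_pos hv hp).1 h1
  · have := h.one_le_ht hv
    exact h.op_elt_of_middle_aux (ht v).toNat v i (by omega) hv hp h1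
  · exact h.op_elt_of_pair_pos hv hp

end IsCorootSystem
end Zhelobenko

/-! ### A model of the monoid -/

namespace Zhelobenko

section Model

variable {I : Type*} [Fintype I] [DecidableEq I]

/-- A model of `𝐏 ∪ {0}`. The vector `v` stands for an element that is obtained from a simple coroot
by simple reflections only, and the pair `(x, q)` stands for a root subsystem of type `B₂` with
orthogonal long coroots `x` and `q`. -/
abbrev Model (I : Type*) : Type _ := Option ((I → ℤ) ⊕ (I → ℤ) × (I → ℤ))

/-- The element of the model given by a vector. -/
def vec (v : I → ℤ) : Model I := some (.inl v)

/-- The element of the model given by a pair of vectors. -/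
def sub (p : (I → ℤ) × (I → ℤ)) : Model I := some (.inr p)

open Classical in
/-- The orthogonal long coroots of the subsystem of type `B₂` spanned by the orthogonal coroots `v`
and `a` of the same length, if there is such a subsystem. -/
noncomputable def span₂ (R : Set (I → ℤ)) (v a : I → ℤ) : Option ((I → ℤ) × (I → ℤ)) :=
  if v + a ∈ R then some (v + a, v - a) else if ∃ w ∈ R, v + a = w + w then some (v, a) else none

/-- The regular vector by which the operators test a pair. -/
def wt (p : (I → ℤ) × (I → ℤ)) : I → ℤ := p.1 + p.1 + p.2

/-- The reflection of a pair. -/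
def refl₂ (C : Matrix I I ℤ) (i : I) (p : (I → ℤ) × (I → ℤ)) : (I → ℤ) × (I → ℤ) :=
  (refl C i p.1, refl C i p.2)

/-- The operator `A_i` on the model. -/
noncomputable def act (C : Matrix I I ℤ) (R : Set (I → ℤ)) (i : I) : Model I → Model I
  | none => none
  | some (.inl v) =>
    if pair C i v < 0 then vec (refl C i v) else
      if pair C i v = 0 then (span₂ R v (unit i)).bind sub else none
  | some (.inr p) => if pair C i (wt p) < 0 then sub (refl₂ C i p) else none

variable {C : Matrix I I ℤ} {R : Set (I → ℤ)} {i j : I} {v a : I → ℤ} {p : (I → ℤ) × (I → ℤ)}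

@[simp] lemma act_none : act C R i none = none := rfl

lemma act_vec_neg (h : pair C i v < 0) : act C R i (vec v) = vec (refl C i v) := if_pos h

lemma act_vec_zero (h : pair C i v = 0) :
    act C R i (vec v) = (span₂ R v (unit i)).bind sub := by
  change ite _ _ _ = _
  rw [if_neg (by omega), if_pos h]

lemma act_vec_pos (h : 0 < pair C i v) : act C R i (vec v) = none := by
  change ite _ _ _ = _
  rw [if_neg (by omega), if_neg (by omega)]

lemma act_sub_neg (h : pair C i (wt p) < 0) : act C R i (sub p) = sub (refl₂ C i p) := if_pos h

lemma act_sub_nonneg (h : 0 ≤ pair C i (wt p)) : act C R i (sub p) = none := if_neg (by omega)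

lemma refl_add (i : I) (v w : I → ℤ) : refl C i (v + w) = refl C i v + refl C i w := by
  simp only [refl, pair_add]; module

lemma refl_sub (i : I) (v w : I → ℤ) : refl C i (v - w) = refl C i v - refl C i w := by
  simp only [refl, pair_sub]; module

lemma wt_refl₂ (i : I) (p : (I → ℤ) × (I → ℤ)) : wt (refl₂ C i p) = refl C i (wt p) := by
  simp only [wt, refl₂, refl_add]

/-- In the second alternative the weaker coefficient 2 is compensated by v + a being divisible by 2,
a parity that removes borderline values of the pairings. -/
lemma wt_of_span₂ (h : span₂ R v a = some p) :
    wt p = (3 : ℤ) • v + a ∨ wt p = (2 : ℤ) • v + a ∧ ∃ w, v + a = w + w := by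
  unfold span₂ at h
  split_ifs at h with h1 h2
  · left
    cases h
    simp only [wt]; module
  · right
    cases h
    obtain ⟨w, -, hw⟩ := h2
    exact ⟨by simp only [wt]; module, w, hw⟩

/-- The values of a simple root on the weight of a pair. -/
lemma pair_wt_of_span₂ (i : I) (h : span₂ R v a = some p) :
    pair C i (wt p) = 3 * pair C i v + pair C i a ∨
      pair C i (wt p) = 2 * pair C i v + pair C i a ∧ Even (pair C i v + pair C i a) := by
  rcases wt_of_span₂ h with h1 | ⟨h1, w, hw⟩
  · left; rw [h1, pair_add, pair_smul]
  · right
    refine ⟨by rw [h1, pair_add, pair_smul], pair C i w, ?_⟩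
    rw [← pair_add, hw, pair_add]

end Model

namespace IsCorootSystem

variable {I : Type*} [Fintype I] [DecidableEq I] {C : Matrix I I ℤ} {R : Set (I → ℤ)} {d : I → ℤ}
  {B : LinearMap.BilinForm ℤ (I → ℤ)} (h : IsCorootSystem C R d B)
  {i j k : I} {v w a : I → ℤ}

include h

/-- The two sides of a relation may form a span at different stages; equivariance makes the results
comparable. -/
lemma span₂_refl (k : I) (v a : I → ℤ) :
    span₂ R (refl C k v) (refl C k a) = (span₂ R v a).map (refl₂ C k) := by
  unfold span₂
  have e1 : refl C k v + refl C k a ∈ R ↔ v + a ∈ R := by rw [← refl_add, h.refl_mem_iff]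
  have e2 : (∃ w ∈ R, refl C k v + refl C k a = w + w) ↔ ∃ w ∈ R, v + a = w + w := by
    constructor
    · rintro ⟨w, hw, he⟩
      refine ⟨refl C k w, h.refl_mem k w hw, ?_⟩
      rw [← refl_add, ← he, ← refl_add, h.refl_refl]
    · rintro ⟨w, hw, he⟩
      exact ⟨refl C k w, h.refl_mem k w hw, by rw [← refl_add, he, refl_add]⟩
  by_cases h1 : v + a ∈ R
  · rw [if_pos (e1.mpr h1), if_pos h1]
    simp [refl₂, refl_add, refl_sub]
  rw [if_neg (e1.not.mpr h1), if_neg h1]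
  by_cases h2 : ∃ w ∈ R, v + a = w + w
  · rw [if_pos (e2.mpr h2), if_pos h2]
    simp [refl₂]
  · rw [if_neg (e2.not.mpr h2), if_neg h2]
    rfl

/-- Whatever survives the first application pairs positively with α_i, either itself or through its
weight. -/
lemma act_act_self (i : I) (x : Model I) : act C R i (act C R i x) = none := by
  rcases x with - | v | p
  · rfl
  · change act C R i (act C R i (vec v)) = none
    rcases lt_trichotomy (pair C i v) 0 with hx | hx | hx
    · rw [act_vec_neg hx, act_vec_pos (by rw [h.pair_refl_self]; omega)]
    · rw [act_vec_zero hx]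
      rcases hs : span₂ R v (unit i) with - | p
      · rfl
      · have := pair_wt_of_span₂ (C := C) i hs
        rw [hx, pair_unit, h.diag] at this
        exact act_sub_nonneg (by omega)
    · rw [act_vec_pos hx]; rfl
  · change act C R i (act C R i (sub p)) = none
    by_cases hx : pair C i (wt p) < 0
    · rw [act_sub_neg hx, act_sub_nonneg (by rw [wt_refl₂, h.pair_refl_self]; omega)]
    · rw [act_sub_nonneg (by omega)]; rfl

/-- The weight of the span of `v` and `unit j` is a positive multiple of `v` plus `unit j`. As `C i
j = 0`, its α_i-pairing has the sign of α_i(v), so forming the span does not affect A_i. -/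
lemma act_act_comm_vec (c1 : C i j = 0) (c2 : C j i = 0) (v : I → ℤ) :
    act C R i (act C R j (vec v)) = act C R j (act C R i (vec v)) := by
  have hr : refl C i (refl C j v) = refl C j (refl C i v) := by
    simp only [refl, pair_sub, pair_smul, pair_unit, c1, c2]; module
  have key : ∀ {i j : I}, C i j = 0 → C j i = 0 → pair C i v < 0 → pair C j v = 0 →
      act C R i (act C R j (vec v)) = act C R j (act C R i (vec v)) := by
    intro i j c1 c2 hx hy
    have hu : unit j = refl C i (unit j) := by rw [refl, pair_unit, c1]; module
    rw [act_vec_zero hy, act_vec_neg hx, act_vec_zero (by rw [pair_refl, hy, c2]; ring)]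
    nth_rw 2 [hu]
    rw [h.span₂_refl]
    rcases hs : span₂ R v (unit j) with - | p
    · rfl
    · have := pair_wt_of_span₂ (C := C) i hs
      rw [pair_unit, c1] at this
      exact act_sub_neg (by omega)
  rcases lt_trichotomy (pair C i v) 0 with hx | hx | hx <;>
    rcases lt_trichotomy (pair C j v) 0 with hy | hy | hy
  · rw [act_vec_neg hx, act_vec_neg hy, act_vec_neg (by rw [pair_refl, c1]; omega),
      act_vec_neg (by rw [pair_refl, c2]; omega), hr]
  · exact key c1 c2 hx hy
  · rw [act_vec_neg hx, act_vec_pos hy, act_vec_pos (by rw [pair_refl, c2]; omega)]; rfl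
  · exact (key c2 c1 hy hx).symm
  · have key' : ∀ {i j : I}, C i j = 0 → pair C i v = 0 → pair C j v = 0 →
        act C R i (act C R j (vec v)) = none := by
      intro i j c1 hx hy
      rw [act_vec_zero hy]
      rcases hs : span₂ R v (unit j) with - | p
      · rfl
      · have := pair_wt_of_span₂ (C := C) i hs
        rw [pair_unit, c1] at this
        exact act_sub_nonneg (by omega)
    rw [key' c1 hx hy, key' c2 hy hx]
  · rw [act_vec_zero hx, act_vec_pos hy]
    rcases hs : span₂ R v (unit i) with - | p
    · rfl
    · have := pair_wt_of_span₂ (C := C) j hs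
      rw [pair_unit, c2] at this
      exact (act_sub_nonneg (by omega)).symm
  · rw [act_vec_neg hy, act_vec_pos hx, act_vec_pos (by rw [pair_refl, c1]; omega)]; rfl
  · rw [act_vec_zero hy, act_vec_pos hx]
    rcases hs : span₂ R v (unit j) with - | p
    · rfl
    · have := pair_wt_of_span₂ (C := C) i hs
      rw [pair_unit, c1] at this
      exact act_sub_nonneg (by omega)
  · rw [act_vec_pos hx, act_vec_pos hy]; rfl

lemma act_act_comm (c1 : C i j = 0) (c2 : C j i = 0) (x : Model I) :
    act C R i (act C R j x) = act C R j (act C R i x) := by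
  rcases x with - | v | p
  · rfl
  · exact h.act_act_comm_vec c1 c2 v
  · change act C R i (act C R j (sub p)) = act C R j (act C R i (sub p))
    have hr : ∀ v, refl C i (refl C j v) = refl C j (refl C i v) := by
      intro v; simp only [refl, pair_sub, pair_smul, pair_unit, c1, c2]; module
    by_cases hx : pair C i (wt p) < 0 <;> by_cases hy : pair C j (wt p) < 0
    · rw [act_sub_neg hx, act_sub_neg hy, act_sub_neg (by rw [wt_refl₂, pair_refl, c1]; omega),
        act_sub_neg (by rw [wt_refl₂, pair_refl, c2]; omega)]
      simp [refl₂, hr]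
    · rw [act_sub_neg hx, act_sub_nonneg (by omega : 0 ≤ pair C j (wt p)),
        act_sub_nonneg (by rw [wt_refl₂, pair_refl, c2]; omega)]; rfl
    · rw [act_sub_neg hy, act_sub_nonneg (by omega : 0 ≤ pair C i (wt p)),
        act_sub_nonneg (by rw [wt_refl₂, pair_refl, c1]; omega)]; rfl
    · rw [act_sub_nonneg (by omega : 0 ≤ pair C j (wt p)),
        act_sub_nonneg (by omega : 0 ≤ pair C i (wt p))]; rfl

lemma refl_braid₁ (c1 : C i j = -1) (c2 : C j i = -1) (v : I → ℤ) :
    refl C i (refl C j (refl C i v)) = refl C j (refl C i (refl C j v)) := by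
  simp only [refl, pair_sub, pair_smul, pair_unit, c1, c2, h.diag]; module

/-- The pairings tested on the way are α_i, α_i + α_j and α_j on the weight, the positive roots of
type A₂, so survival is a condition symmetric in i and j. -/
lemma act_braid₁_sub (c1 : C i j = -1) (c2 : C j i = -1) (p : (I → ℤ) × (I → ℤ)) :
    act C R i (act C R j (act C R i (sub p))) = if pair C i (wt p) < 0 ∧ pair C j (wt p) < 0 then
      sub (refl₂ C i (refl₂ C j (refl₂ C i p))) else none := by
  have e1 : pair C j (wt (refl₂ C i p)) = pair C i (wt p) + pair C j (wt p) := by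
    rw [wt_refl₂, pair_refl, c2]; ring
  have e2 : pair C i (wt (refl₂ C j (refl₂ C i p))) = pair C j (wt p) := by
    rw [wt_refl₂, pair_refl, e1, wt_refl₂, h.pair_refl_self, c1]; ring
  split_ifs with hc
  · rw [act_sub_neg hc.1, act_sub_neg (by omega), act_sub_neg (by omega)]
  · by_cases hx : pair C i (wt p) < 0
    · rw [act_sub_neg hx]
      by_cases hxy : pair C j (wt (refl₂ C i p)) < 0
      · rw [act_sub_neg hxy, act_sub_nonneg (by omega)]
      · rw [act_sub_nonneg (by omega), act_none]
    · rw [act_sub_nonneg (by omega), act_none, act_none]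

/-- Exchanging i and j only swaps the two middle cases, so this closed form yields the braid
relation. A zero pairing is harmless in the first or last of the three tests and fatal in the middle
one. -/
lemma act_braid₁_vec (c1 : C i j = -1) (c2 : C j i = -1) (v : I → ℤ) :
    act C R i (act C R j (act C R i (vec v))) =
      if pair C i v < 0 ∧ pair C j v < 0 then vec (refl C i (refl C j (refl C i v)))
      else if pair C i v < 0 ∧ pair C j v = 0 then
        ((span₂ R v (unit j)).map (refl₂ C i)).bind fun p ↦ sub (refl₂ C j p)
      else if pair C i v = 0 ∧ pair C j v < 0 then
        ((span₂ R v (unit i)).map (refl₂ C j)).bind fun p ↦ sub (refl₂ C i p)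
      else none := by
  have e1 : pair C j (refl C i v) = pair C i v + pair C j v := by rw [pair_refl, c2]; ring
  have e2 : pair C i (refl C j (refl C i v)) = pair C j v := by
    rw [pair_refl, e1, h.pair_refl_self, c1]; ring
  -- The reflections carry α_j^∨ to α_i^∨, so a span formed at the last letter is the image of the
  -- span of `v` and `unit j`.
  have hu : unit i = refl C j (refl C i (unit j)) := by
    simp only [refl, pair_sub, pair_smul, pair_unit, h.diag, c1, c2]; module
  rcases lt_trichotomy (pair C i v) 0 with hx | hx | hx
  · rw [act_vec_neg hx]
    rcases lt_trichotomy (pair C j (refl C i v)) 0 with hxy | hxy | hxy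
    · rw [act_vec_neg hxy]
      rcases lt_trichotomy (pair C j v) 0 with hy | hy | hy
      · rw [act_vec_neg (by omega), if_pos ⟨hx, hy⟩]
      · rw [act_vec_zero (by omega), if_neg (by omega), if_pos ⟨hx, hy⟩]
        nth_rw 1 [hu]
        rw [h.span₂_refl, h.span₂_refl]
        cases span₂ R v (unit j) <;> rfl
      · rw [act_vec_pos (by omega), if_neg (by omega), if_neg (by omega), if_neg (by omega)]
    · rw [act_vec_zero hxy, if_neg (by omega), if_neg (by omega), if_neg (by omega)]
      rcases hs : span₂ R (refl C i v) (unit j) with - | p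
      · rfl
      · have := pair_wt_of_span₂ (C := C) i hs
        rw [h.pair_refl_self, pair_unit, c1] at this
        exact act_sub_nonneg (by omega)
    · rw [act_vec_pos hxy, if_neg (by omega), if_neg (by omega), if_neg (by omega)]
      rfl
  · rw [act_vec_zero hx, if_neg (by omega), if_neg (by omega)]
    rcases hs : span₂ R v (unit i) with - | p
    · simp
    have h1 := pair_wt_of_span₂ (C := C) i hs
    have h2 := pair_wt_of_span₂ (C := C) j hs
    rw [pair_unit, h.diag] at h1
    rw [pair_unit, c2] at h2
    have e3 : pair C i (wt (refl₂ C j p)) = pair C i (wt p) + pair C j (wt p) := by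
      rw [wt_refl₂, pair_refl, c1]; ring
    change act C R i (act C R j (sub p)) = _
    rcases lt_trichotomy (pair C j v) 0 with hy | hy | hy
    · rw [act_sub_neg (by omega), act_sub_neg (by rcases wt_of_span₂ hs with h3 | h3 <;> omega),
        if_pos ⟨hx, hy⟩]
      rfl
    · rw [act_sub_neg (by omega), act_sub_nonneg (by omega), if_neg (by omega)]
    · rw [act_sub_nonneg (by omega), if_neg (by omega), act_none]
  · rw [act_vec_pos hx, if_neg (by omega), if_neg (by omega), if_neg (by omega)]
    rfl

lemma act_braid₁ (c1 : C i j = -1) (c2 : C j i = -1) (x : Model I) :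
    act C R i (act C R j (act C R i x)) = act C R j (act C R i (act C R j x)) := by
  rcases x with - | v | p
  · rfl
  · change act C R i (act C R j (act C R i (vec v))) = act C R j (act C R i (act C R j (vec v)))
    rw [h.act_braid₁_vec c1 c2, h.act_braid₁_vec c2 c1, h.refl_braid₁ c1 c2]
    split_ifs <;> first | rfl | omega
  · change act C R i (act C R j (act C R i (sub p))) = act C R j (act C R i (act C R j (sub p)))
    rw [h.act_braid₁_sub c1 c2, h.act_braid₁_sub c2 c1]
    simp only [refl₂, h.refl_braid₁ c1 c2]
    exact if_congr and_comm rfl rfl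

end IsCorootSystem
end Zhelobenko

namespace Zhelobenko
namespace IsCorootSystem

variable {I : Type*} [Fintype I] [DecidableEq I] {C : Matrix I I ℤ} {R : Set (I → ℤ)} {d : I → ℤ}
  {B : LinearMap.BilinForm ℤ (I → ℤ)} (h : IsCorootSystem C R d B)
  {i j k : I} {v w a : I → ℤ}

include h

lemma refl_braid₂ (c : C i j = -2 ∧ C j i = -1 ∨ C i j = -1 ∧ C j i = -2) (v : I → ℤ) :
    refl C i (refl C j (refl C i (refl C j v))) = refl C j (refl C i (refl C j (refl C i v))) := by
  rcases c with ⟨c1, c2⟩ | ⟨c1, c2⟩ <;>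
  · simp only [refl, pair_sub, pair_smul, pair_unit, c1, c2, h.diag]; module

lemma act_braid₂_sub (c : C i j = -2 ∧ C j i = -1 ∨ C i j = -1 ∧ C j i = -2)
    (p : (I → ℤ) × (I → ℤ)) :
    act C R i (act C R j (act C R i (act C R j (sub p)))) =
      if pair C i (wt p) < 0 ∧ pair C j (wt p) < 0 then
        sub (refl₂ C i (refl₂ C j (refl₂ C i (refl₂ C j p)))) else none := by
  have e1 : pair C i (wt (refl₂ C j p)) = pair C i (wt p) - C i j * pair C j (wt p) := by
    rw [wt_refl₂, pair_refl]; ring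
  have e2 : pair C j (wt (refl₂ C i (refl₂ C j p))) =
      pair C j (wt p) - C j i * pair C i (wt p) := by
    rw [wt_refl₂, pair_refl, e1, wt_refl₂, h.pair_refl_self]
    rcases c with ⟨c1, c2⟩ | ⟨c1, c2⟩ <;> rw [c1, c2] <;> ring
  have e3 : pair C i (wt (refl₂ C j (refl₂ C i (refl₂ C j p)))) = pair C i (wt p) := by
    rw [wt_refl₂, pair_refl, e2, wt_refl₂, h.pair_refl_self, e1]
    rcases c with ⟨c1, c2⟩ | ⟨c1, c2⟩ <;> rw [c1, c2] <;> ring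
  have e1' : pair C i (wt (refl₂ C j p)) = pair C i (wt p) + 2 * pair C j (wt p) ∧
      pair C j (wt (refl₂ C i (refl₂ C j p))) = pair C j (wt p) + pair C i (wt p) ∨
      pair C i (wt (refl₂ C j p)) = pair C i (wt p) + pair C j (wt p) ∧
      pair C j (wt (refl₂ C i (refl₂ C j p))) = pair C j (wt p) + 2 * pair C i (wt p) := by
    rw [e1, e2]
    rcases c with ⟨c1, c2⟩ | ⟨c1, c2⟩ <;> rw [c1, c2]
    · left; constructor <;> ring
    · right; constructor <;> ring
  split_ifs with hc
  · rw [act_sub_neg hc.2, act_sub_neg (by omega), act_sub_neg (by omega), act_sub_neg (by omega)]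
  · by_cases hy : pair C j (wt p) < 0
    · rw [act_sub_neg hy]
      by_cases h1 : pair C i (wt (refl₂ C j p)) < 0
      · rw [act_sub_neg h1]
        by_cases h2 : pair C j (wt (refl₂ C i (refl₂ C j p))) < 0
        · rw [act_sub_neg h2, act_sub_nonneg (by omega)]
        · rw [act_sub_nonneg (by omega), act_none]
      · rw [act_sub_nonneg (by omega), act_none, act_none]
    · rw [act_sub_nonneg (by omega), act_none, act_none, act_none]

lemma act_braid₂_vec (c : C i j = -2 ∧ C j i = -1 ∨ C i j = -1 ∧ C j i = -2) (v : I → ℤ) :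
    act C R i (act C R j (act C R i (act C R j (vec v)))) =
      if pair C i v < 0 ∧ pair C j v < 0 then
        vec (refl C i (refl C j (refl C i (refl C j v))))
      else if pair C i v < 0 ∧ pair C j v = 0 then
        (span₂ R v (unit j)).bind fun p ↦ sub (refl₂ C i (refl₂ C j (refl₂ C i p)))
      else if pair C i v = 0 ∧ pair C j v < 0 then
        (span₂ R v (unit i)).bind fun p ↦ sub (refl₂ C j (refl₂ C i (refl₂ C j p)))
      else none := by
  have e1 : pair C i (refl C j v) = pair C i v - C i j * pair C j v := by
    rw [pair_refl]; ring
  have e2 : pair C j (refl C i (refl C j v)) =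
      pair C j v - C j i * pair C i v := by
    rw [pair_refl, e1, h.pair_refl_self]
    rcases c with ⟨c1, c2⟩ | ⟨c1, c2⟩ <;> rw [c1, c2] <;> ring
  have e3 : pair C i (refl C j (refl C i (refl C j v))) = pair C i v := by
    rw [pair_refl, e2, h.pair_refl_self, e1]
    rcases c with ⟨c1, c2⟩ | ⟨c1, c2⟩ <;> rw [c1, c2] <;> ring
  have e4 : pair C i (refl C i (refl C j v)) = -pair C i (refl C j v) := h.pair_refl_self _ _
  have hu : unit i = refl C j (refl C i (refl C j (unit i))) := by
    rcases c with ⟨c1, c2⟩ | ⟨c1, c2⟩ <;>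
    · simp only [refl, pair_sub, pair_smul, pair_unit, h.diag, c1, c2]; module
  have e1' : C i j = -2 ∧ pair C i (refl C j v) = pair C i v + 2 * pair C j v ∧ C j i = -1 ∧
      pair C j (refl C i (refl C j v)) = pair C j v + pair C i v ∨
      C i j = -1 ∧ pair C i (refl C j v) = pair C i v + pair C j v ∧ C j i = -2 ∧
      pair C j (refl C i (refl C j v)) = pair C j v + 2 * pair C i v := by
    rw [e1, e2]
    rcases c with ⟨c1, c2⟩ | ⟨c1, c2⟩ <;> rw [c1, c2]
    · left; refine ⟨rfl, ?_, rfl, ?_⟩ <;> ring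
    · right; refine ⟨rfl, ?_, rfl, ?_⟩ <;> ring
  rcases lt_trichotomy (pair C j v) 0 with hy | hy | hy
  · rw [act_vec_neg hy]
    rcases lt_trichotomy (pair C i (refl C j v)) 0 with h1 | h1 | h1
    · rw [act_vec_neg h1]
      rcases lt_trichotomy (pair C j (refl C i (refl C j v))) 0 with h2 | h2 | h2
      · rw [act_vec_neg h2]
        rcases lt_trichotomy (pair C i v) 0 with hx | hx | hx
        · rw [act_vec_neg (by omega), if_pos ⟨hx, hy⟩]
        · rw [act_vec_zero (by omega), if_neg (by omega), if_neg (by omega), if_pos ⟨hx, hy⟩]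
          nth_rw 1 [hu]
          rw [h.span₂_refl, h.span₂_refl, h.span₂_refl]
          cases span₂ R v (unit i) <;> rfl
        · rw [act_vec_pos (by omega), if_neg (by omega), if_neg (by omega), if_neg (by omega)]
      · rw [act_vec_zero h2, if_neg (by omega), if_neg (by omega), if_neg (by omega)]
        rcases hs : span₂ R (refl C i (refl C j v)) (unit j) with - | p
        · rfl
        · have := pair_wt_of_span₂ (C := C) i hs
          rw [e4, pair_unit] at this
          exact act_sub_nonneg (by omega)
      · rw [act_vec_pos h2, if_neg (by omega), if_neg (by omega), if_neg (by omega)]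
        rfl
    · rw [act_vec_zero h1, if_neg (by omega), if_neg (by omega), if_neg (by omega)]
      rcases hs : span₂ R (refl C j v) (unit i) with - | p
      · rfl
      · have := pair_wt_of_span₂ (C := C) j hs
        rw [h.pair_refl_self, pair_unit] at this
        change act C R i (act C R j (sub p)) = none
        rw [act_sub_nonneg (by omega), act_none]
    · rw [act_vec_pos h1, if_neg (by omega), if_neg (by omega), if_neg (by omega)]
      rfl
  · rw [act_vec_zero hy, if_neg (by omega)]
    rcases hs : span₂ R v (unit j) with - | p
    · rw [if_neg (by omega : ¬(pair C i v = 0 ∧ pair C j v < 0))]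
      simp
    have h1 := pair_wt_of_span₂ (C := C) i hs
    have h2 := pair_wt_of_span₂ (C := C) j hs
    rw [pair_unit, h.diag] at h2
    rw [pair_unit] at h1
    -- Without the parity, α_i(v) = -1 and `C i j = -2` would give 2α_i(v) + C i j + 4 = 0 in the
    -- last test, where a negative value is required.
    have h1' : pair C i (wt p) = 3 * pair C i v + C i j ∨
        pair C i (wt p) = 2 * pair C i v + C i j ∧ pair C i v % 2 = C i j % 2 := by
      rcases h1 with h1 | ⟨h1, m, hm⟩
      · exact Or.inl h1
      · exact Or.inr ⟨h1, by omega⟩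
    have e5 : pair C j (wt (refl₂ C i p)) = pair C j (wt p) - pair C i (wt p) * C j i := by
      rw [wt_refl₂, pair_refl]
    have e6 : pair C i (wt (refl₂ C j (refl₂ C i p))) =
        pair C i (wt p) - C i j * pair C j (wt p) := by
      rw [wt_refl₂, pair_refl, e5, wt_refl₂, h.pair_refl_self]
      rcases c with ⟨c1, c2⟩ | ⟨c1, c2⟩ <;> rw [c1, c2] <;> ring
    have e5' : C i j = -2 ∧ C j i = -1 ∧
          pair C j (wt (refl₂ C i p)) = pair C j (wt p) + pair C i (wt p) ∧
          pair C i (wt (refl₂ C j (refl₂ C i p))) = pair C i (wt p) + 2 * pair C j (wt p) ∨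
        C i j = -1 ∧ C j i = -2 ∧
          pair C j (wt (refl₂ C i p)) = pair C j (wt p) + 2 * pair C i (wt p) ∧
          pair C i (wt (refl₂ C j (refl₂ C i p))) = pair C i (wt p) + pair C j (wt p) := by
      rw [e5, e6]
      rcases c with ⟨c1, c2⟩ | ⟨c1, c2⟩ <;> rw [c1, c2]
      · left; refine ⟨rfl, rfl, ?_, ?_⟩ <;> ring
      · right; refine ⟨rfl, rfl, ?_, ?_⟩ <;> ring
    change act C R i (act C R j (act C R i (sub p))) = _
    rcases lt_trichotomy (pair C i v) 0 with hx | hx | hx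
    · rw [if_pos ⟨hx, hy⟩, act_sub_neg (by omega), act_sub_neg (by omega), act_sub_neg (by omega)]
      rfl
    · rw [act_sub_neg (by omega), act_sub_nonneg (by omega), act_none, if_neg (by omega),
        if_neg (by omega)]
    · rw [act_sub_nonneg (by omega), if_neg (by omega), if_neg (by omega)]
      rfl
  · rw [act_vec_pos hy, if_neg (by omega), if_neg (by omega), if_neg (by omega)]
    rfl

lemma act_braid₂ (c : C i j = -2 ∧ C j i = -1 ∨ C i j = -1 ∧ C j i = -2) (x : Model I) :
    act C R i (act C R j (act C R i (act C R j x))) =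
      act C R j (act C R i (act C R j (act C R i x))) := by
  rcases x with - | v | p
  · rfl
  · change act C R i (act C R j (act C R i (act C R j (vec v)))) =
      act C R j (act C R i (act C R j (act C R i (vec v))))
    rw [h.act_braid₂_vec c, h.act_braid₂_vec (by omega), h.refl_braid₂ c]
    split_ifs <;> first | rfl | omega
  · change act C R i (act C R j (act C R i (act C R j (sub p)))) =
      act C R j (act C R i (act C R j (act C R i (sub p))))
    rw [h.act_braid₂_sub c, h.act_braid₂_sub (by omega)]
    simp only [refl₂, h.refl_braid₂ c]
    exact if_congr and_comm rfl rfl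

/-- Its squared length would be 8 or 16. -/
lemma double_notMem (hw : w ∈ R) : w + w ∉ R := by
  intro hm
  have h1 := h.form_self _ hw
  have h2 := h.form_self _ hm
  simp only [map_add, LinearMap.add_apply] at h2
  omega

lemma act_gen_orth (c1 : C i j = 0) (c2 : C j i = 0) : act C R i (vec (unit j)) = none := by
  have hij : i ≠ j := by rintro rfl; simp [h.diag] at c1
  rw [act_vec_zero (by rw [pair_unit, c1])]
  have hs : span₂ R (unit j) (unit i) = none := by
    unfold span₂
    rw [if_neg (h.unit_add_unit_notMem c2), if_neg]
    rintro ⟨w, -, hw⟩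
    have := congrFun hw i
    simp [unit_same, unit_ne hij] at this
    omega
  rw [hs]; rfl

lemma act_gen_swap (c1 : C i j = -1) (c2 : C j i = -1) :
    act C R i (vec (unit j)) = act C R j (vec (unit i)) := by
  rw [act_vec_neg (by rw [pair_unit, c1]; norm_num), act_vec_neg (by rw [pair_unit, c2]; norm_num),
    refl, refl, pair_unit, pair_unit, c1, c2]
  congr 1
  module

/-- Both sides reach the same B₂ subsystem with long coroots 2α_i^∨ + α_j^∨ and α_j^∨: one from
these two long coroots, the other from the short ones α_i^∨ + α_j^∨ and α_i^∨. This is why the model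
records the long pair. -/
lemma act_act_gen_swap (c1 : C i j = -2) (c2 : C j i = -1) :
    act C R j (act C R i (vec (unit j))) = act C R i (act C R j (vec (unit i))) := by
  have hm1 : unit i + unit j ∈ R := by
    have := h.refl_mem j _ (h.unit_mem i)
    rw [refl, pair_unit, c2] at this
    convert this using 1; module
  have hm2 : unit i + unit j + unit i ∈ R := by
    have := h.refl_mem i _ (h.unit_mem j)
    rw [refl, pair_unit, c1] at this
    convert this using 1; module
  have e1 : refl C i (unit j) = unit i + unit j + unit i := by
    rw [refl, pair_unit, c1]; module
  have e2 : refl C j (unit i) = unit i + unit j := by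
    rw [refl, pair_unit, c2]; module
  rw [act_vec_neg (i := i) (v := unit j) (by rw [pair_unit, c1]; norm_num),
    act_vec_neg (i := j) (v := unit i) (by rw [pair_unit, c2]; norm_num),
    e1, e2, act_vec_zero (by simp only [pair_add, pair_unit, h.diag, c2]; norm_num),
    act_vec_zero (by simp only [pair_add, pair_unit, h.diag, c1]; norm_num)]
  have s1 : span₂ R (unit i + unit j + unit i) (unit j) =
      some (unit i + unit j + unit i, unit j) := by
    have he : unit i + unit j + unit i + unit j = (unit i + unit j) + (unit i + unit j) := by abel
    unfold span₂
    rw [if_neg (by rw [he]; exact h.double_notMem hm1), if_pos ⟨_, hm1, he⟩]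
  have s2 : span₂ R (unit i + unit j) (unit i) =
      some (unit i + unit j + unit i, unit j) := by
    unfold span₂
    rw [if_pos hm2, add_sub_cancel_left]
  rw [s1, s2]

end IsCorootSystem

/-! ### Evaluation in the model: 𝒫 is nonzero and injective -/

section Eval

variable {I : Type*} [Fintype I] [DecidableEq I]

/-- The value of a formal expression in the model. -/
noncomputable def exprValue (C : Matrix I I ℤ) (R : Set (I → ℤ)) : Expr I → Model I
  | none => none
  | some (u, k) => u.foldr (act C R) (vec (unit k))

variable {C : Matrix I I ℤ} {R : Set (I → ℤ)} {d : I → ℤ}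
  {B : LinearMap.BilinForm ℤ (I → ℤ)} (h : IsCorootSystem C R d B)

lemma foldr_act_none (u : List I) : u.foldr (act C R) none = none := by
  induction u with
  | nil => rfl
  | cons i u ih => rw [List.foldr_cons, ih]; rfl

include h in
lemma exprValue_eq_of_step {x y : Expr I} (hxy : Step C x y) : exprValue C R x = exprValue C R y := by
  cases hxy with
  | sq u v i k =>
    simp only [exprValue, List.foldr_append, List.foldr_cons, List.foldr_nil, h.act_act_self,
      foldr_act_none]
  | kill u i =>
    simp only [exprValue, List.foldr_append, List.foldr_cons, List.foldr_nil]
    rw [act_vec_pos (by rw [pair_unit, h.diag]; norm_num), foldr_act_none]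
  | comm u v i j k hm =>
    obtain ⟨-, c1, c2⟩ := h.cartan_prod_zero hm
    simp only [exprValue, List.foldr_append, List.foldr_cons, List.foldr_nil, h.act_act_comm c1 c2]
  | orth u i j hm =>
    obtain ⟨-, c1, c2⟩ := h.cartan_prod_zero hm
    simp only [exprValue, List.foldr_append, List.foldr_cons, List.foldr_nil, h.act_gen_orth c1 c2,
      foldr_act_none]
  | braid₁ u v i j k hm =>
    obtain ⟨-, c1, c2⟩ := h.cartan_prod_one hm
    simp only [exprValue, List.foldr_append, List.foldr_cons, List.foldr_nil]
    rw [h.act_braid₁ c1 c2]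
  | swap₁ u i j hm =>
    obtain ⟨-, c1, c2⟩ := h.cartan_prod_one hm
    simp only [exprValue, List.foldr_append, List.foldr_cons, List.foldr_nil]
    rw [h.act_gen_swap c1 c2]
  | braid₂ u v i j k hm =>
    simp only [exprValue, List.foldr_append, List.foldr_cons, List.foldr_nil]
    rw [h.act_braid₂ (h.cartan_prod_two hm).2]
  | swap₂ u i j hm =>
    simp only [exprValue, List.foldr_append, List.foldr_cons, List.foldr_nil]
    obtain ⟨-, ⟨c1, c2⟩ | ⟨c1, c2⟩⟩ := h.cartan_prod_two hm
    · rw [h.act_act_gen_swap c1 c2]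
    · rw [h.act_act_gen_swap c2 c1]
  | braid₃ u v i j k hm => exact absurd hm h.cartan_prod_ne_three
  | swap₃ u i j hm => exact absurd hm h.cartan_prod_ne_three

/-- The map from `𝐏 ∪ {0}` to the model. -/
noncomputable def eval : PointedMonoid C → Model I :=
  Quot.lift (exprValue C R) fun _ _ ↦ exprValue_eq_of_step h

lemma eval_op (i : I) (x : PointedMonoid C) : eval h (op i x) = act C R i (eval h x) := by
  induction x using Quot.ind with
  | mk x => rcases x with - | ⟨v, k⟩ <;> rfl

lemma eval_zero : eval h 0 = none := rfl

end Eval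

namespace IsCorootSystem

variable {I : Type*} [Fintype I] [DecidableEq I] {C : Matrix I I ℤ} {R : Set (I → ℤ)} {d : I → ℤ}
  {B : LinearMap.BilinForm ℤ (I → ℤ)} (h : IsCorootSystem C R d B)
  {i j k : I} {v w a : I → ℤ}

include h

/-- Induction along a path. An ascent from pairing -1 is a reflection; an ascent from the middle of
a string replaces v by the pair of its two ends, v + α_i^∨ and v - α_i^∨. -/
lemma eval_elt (hv : v ∈ R ∧ 0 ≤ v) :
    eval h (elt C R v) = vec v ∨
      ∃ q, eval h (elt C R v) = sub (v, q) ∧ B v v = 4 ∧ q ∈ R ∧ B q q = 4 ∧ B v q = 0 := by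
  have hp := h.path_elt hv
  generalize elt C R v = x at hp
  induction hp with
  | gen i => exact Or.inl rfl
  | step i v x _ hv' hm hpos ih =>
    have hp0 := h.pair_le_two (i := i) hm
    rw [pair_add, pair_unit, h.diag] at hpos hp0
    have ih := ih hv'
    rw [eval_op]
    by_cases hx : pair C i v = 0
    · obtain ⟨l1, l2, l3, hm'⟩ := h.middle hv'.1 hx hm
      have e1 : eval h x = vec v := by
        rcases ih with ih | ⟨q, -, l4, -⟩
        · exact ih
        · omega
      refine Or.inr ⟨v - unit i, ?_, l3, hm', ?_, ?_⟩
      · rw [e1, act_vec_zero hx]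
        unfold span₂
        rw [if_pos hm]
        rfl
      · rw [h.form_sub_unit, l1, l2, hx]; ring
      · rw [map_sub, map_add, LinearMap.add_apply, LinearMap.add_apply, h.form_unit_right,
          h.form_unit_right, h.form_unit, l1, hx, pair_unit, h.diag, l2]
        norm_num
    · have hx1 : pair C i v = -1 := by omega
      have er : refl C i v = v + unit i := by rw [refl, hx1]; module
      rcases ih with ih | ⟨q, ih, l1, hq, l2, l3⟩
      · left
        rw [ih, act_vec_neg (by omega), er]
      · right
        have hdi : d i = 2 := by
          have ev := h.pair_even i v hv'.1 l1
          rw [hx1] at ev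
          rcases h.len_simple i with hd | hd
          · exact absurd (ev hd) (by decide)
          · exact hd
        -- The weight 2v + q must be negative on α_i, where α_i(v) = -1. Orthogonality excludes q =
        -- α_i^∨, and the value 2 on any other coroot would make α_i^∨ short.
        have hqi : pair C i q < 2 := by
          by_cases he : q = unit i
          · rw [he, h.form_unit_right, hx1, hdi] at l3
            omega
          · by_contra hge
            have := h.pair_two hq he (by have := h.pair_le_two (i := i) hq; omega)
            omega
        refine ⟨refl C i q, ?_, ?_, h.refl_mem i q hq, ?_, ?_⟩
        · rw [ih, act_sub_neg (by simp only [wt, pair_add]; omega), refl₂, er]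
        · rw [← er, h.form_refl, l1]
        · rw [h.form_refl, l2]
        · rw [← er, h.form_refl, l3]

lemma elt_ne_zero (hv : v ∈ R ∧ 0 ≤ v) : elt C R v ≠ 0 := by
  intro h0
  have := h.eval_elt hv
  rw [h0, eval_zero] at this
  rcases this with h1 | ⟨q, h1, -⟩ <;> cases h1

lemma elt_injective (hv : v ∈ R ∧ 0 ≤ v) (hw : w ∈ R ∧ 0 ≤ w) (he : elt C R v = elt C R w) :
    v = w := by
  rcases h.eval_elt hv with h1 | ⟨q, h1, -⟩ <;> rcases h.eval_elt hw with h2 | ⟨q', h2, -⟩ <;>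
    rw [he, h2] at h1 <;> cases h1 <;> rfl

end IsCorootSystem
end Zhelobenko

/-! ### Coefficient vectors of an abstract root system -/

namespace Zhelobenko

section Bridge

variable {ι K M N : Type*} [Finite ι] [Field K] [CharZero K] [AddCommGroup M] [Module K M]
  [AddCommGroup N] [Module K N] {Q : RootPairing ι K M N} [Q.IsCrystallographic]

/-- The integral combination of simple roots with the given coefficients. -/
def combination (c : Q.Base) (v : c.support → ℤ) : M := ∑ i, v i • Q.root i

lemma combination_add (c : Q.Base) (v w : c.support → ℤ) :
    combination c (v + w) = combination c v + combination c w := by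
  simp [combination, add_smul, Finset.sum_add_distrib]

lemma combination_sub (c : Q.Base) (v w : c.support → ℤ) :
    combination c (v - w) = combination c v - combination c w := by
  simp [combination, sub_smul, Finset.sum_sub_distrib]

lemma combination_neg (c : Q.Base) (v : c.support → ℤ) :
    combination c (-v) = -combination c v := by
  simp [combination]

lemma combination_smul (c : Q.Base) (z : ℤ) (v : c.support → ℤ) :
    combination c (z • v) = z • combination c v := by
  simp [combination, mul_smul, Finset.smul_sum]

lemma combination_injective (c : Q.Base) : Function.Injective (combination c) := by
  intro v w hvw
  exact funext (Fintype.linearIndependent_iffₛ.mp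
    (c.linearIndepOn_root.restrict_scalars' ℤ) v w hvw)

section
variable [DecidableEq ι]

lemma combination_unit (c : Q.Base) (i : c.support) : combination c (unit i) = Q.root i := by
  simp [combination, unit, Pi.single_apply, ite_smul]

end

lemma exists_coords (c : Q.Base) (γ : ι) : ∃ v : c.support → ℤ, combination c v = Q.root γ ∧
    (0 ≤ v ∨ v ≤ 0) := by
  obtain ⟨f, -, hf, h⟩ := c.exists_root_eq_sum_int γ
  refine ⟨fun i ↦ f i, ?_, ?_⟩
  · rw [h, combination]
    exact (Finset.sum_coe_sort c.support (fun j ↦ f j • Q.root j))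
  · rcases hf with hf | hf
    · exact Or.inl fun i ↦ hf.le i
    · exact Or.inr fun i ↦ hf.le i

/-- The coefficients of a root with respect to the simple roots. -/
noncomputable def coords (c : Q.Base) (γ : ι) : c.support → ℤ := (exists_coords c γ).choose

lemma combination_coords (c : Q.Base) (γ : ι) : combination c (coords c γ) = Q.root γ :=
  (exists_coords c γ).choose_spec.1

lemma coords_nonneg_or (c : Q.Base) (γ : ι) : 0 ≤ coords c γ ∨ coords c γ ≤ 0 :=
  (exists_coords c γ).choose_spec.2

/-- The coefficient vectors of the roots. -/
def coordSet (c : Q.Base) : Set (c.support → ℤ) := {v | combination c v ∈ Set.range Q.root}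

lemma coords_mem (c : Q.Base) (γ : ι) : coords c γ ∈ coordSet c := ⟨γ, (combination_coords c γ).symm⟩

lemma eq_coords (c : Q.Base) {v : c.support → ℤ} {γ : ι} (h : combination c v = Q.root γ) :
    v = coords c γ :=
  combination_injective c (h.trans (combination_coords c γ).symm)

lemma exists_eq_coords (c : Q.Base) {v : c.support → ℤ} (h : v ∈ coordSet c) :
    ∃ γ, v = coords c γ := by
  obtain ⟨γ, hγ⟩ := h
  exact ⟨γ, eq_coords c hγ.symm⟩

lemma height_eq_ht (c : Q.Base) (γ : ι) : c.height γ = ht (coords c γ) := by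
  classical
  let f : ι → ℤ := fun j ↦ if hj : j ∈ c.support then coords c γ ⟨j, hj⟩ else 0
  have hf : ∀ j : c.support, f j = coords c γ j := fun j ↦ by simp [f]
  have h1 : Q.root γ = ∑ j ∈ c.support, f j • Q.root j := by
    rw [← combination_coords c γ, combination, ← Finset.sum_coe_sort c.support]
    simp only [hf]
  rw [c.height_eq_sum h1, ← Finset.sum_coe_sort c.support, ht]
  simp only [hf]

lemma isPos_iff_coords_nonneg (c : Q.Base) (γ : ι) : c.IsPos γ ↔ 0 ≤ coords c γ := by
  rw [c.isPos_iff', height_eq_ht]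
  constructor
  · intro h
    rcases coords_nonneg_or c γ with h1 | h1
    · exact h1
    · by_contra hne
      have h2 : ht (coords c γ) = 0 :=
        le_antisymm (Finset.sum_nonpos fun i _ ↦ h1 i) h
      rw [← height_eq_ht] at h2
      exact c.height_ne_zero γ h2
  · intro h
    exact Finset.sum_nonneg fun i _ ↦ h i

variable [DecidableEq ι]

lemma pair_coords (c : Q.Base) (γ : ι) (i : c.support) :
    pair c.cartanMatrix.transpose i (coords c γ) = Q.pairingIn ℤ γ i := by
  apply FaithfulSMul.algebraMap_injective ℤ K
  rw [Q.algebraMap_pairingIn, ← Q.root_coroot_eq_pairing, ← combination_coords c γ, combination,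
    map_sum, LinearMap.sum_apply, pair, map_sum]
  refine Finset.sum_congr rfl fun j _ ↦ ?_
  rw [Matrix.transpose_apply, map_mul, RootPairing.Base.algebraMap_cartanMatrixIn_apply ℤ c,
    map_zsmul, LinearMap.smul_apply, zsmul_eq_mul, Q.root_coroot_eq_pairing, eq_intCast, mul_comm]

lemma coords_simple (c : Q.Base) (i : c.support) : coords c i = unit i :=
  (eq_coords c (combination_unit c i)).symm

lemma coords_reflectionPerm (c : Q.Base) (i : c.support) (γ : ι) :
    coords c (Q.reflectionPerm i γ) = refl c.cartanMatrix.transpose i (coords c γ) := by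
  symm
  apply eq_coords
  rw [refl, pair_coords, combination_sub, combination_smul, combination_unit, combination_coords,
    Q.root_reflectionPerm, Q.reflection_apply_root' ℤ]

section Length

variable [Q.IsReduced] [Q.IsIrreducible]

/-- Irreducibility provides a root of the length of δ that is not orthogonal to γ. Pairings of
absolute value at most 2 then leave only the length ratios 1, 2 and 1/2. The value `d = 2` marks
roots twice as long, in squared length, as some other root. -/
lemma exists_normalized_length (hG : ∀ i j, Q.pairingIn ℤ i j ∈ ({-2, -1, 0, 1, 2} : Set ℤ)) :
    ∃ (F : Q.RootPositiveForm ℤ) (d : ι → ℤ), (∀ γ, d γ = 1 ∨ d γ = 2) ∧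
      ∀ γ δ, F.rootLength γ * d δ = F.rootLength δ * d γ := by
  classical
  have := Fintype.ofFinite ι
  let F := Q.posRootForm ℤ
  have tri : ∀ γ δ, F.rootLength γ = F.rootLength δ ∨ F.rootLength γ = 2 * F.rootLength δ ∨
      F.rootLength δ = 2 * F.rootLength γ := by
    intro γ δ
    obtain ⟨k, hk, hk0⟩ := Q.exists_form_eq_form_and_form_ne_zero F.toInvariantForm γ δ
    have hkl : F.rootLength k = F.rootLength δ := by
      apply FaithfulSMul.algebraMap_injective ℤ K
      rw [F.algebraMap_rootLength, F.algebraMap_rootLength]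
      exact hk
    rw [← hkl]
    have h1 : Q.pairingIn ℤ γ k ≠ 0 := by
      intro h0
      apply hk0
      rw [F.toInvariantForm.apply_root_root_zero_iff, ← Q.algebraMap_pairingIn ℤ, h0, map_zero]
    have h2 := Q.pairingIn_pairingIn_mem_set_of_isCrystal_of_isRed γ k
    have h3 := F.pairingIn_mul_eq_pairingIn_mul_swap γ k
    have h4 := hG γ k
    have h5 := hG k γ
    simp only [Set.mem_insert_iff, Set.mem_singleton_iff, Prod.mk.injEq] at h2 h4 h5
    rcases h2 with h2 | h2 | h2 | h2 | h2 | h2 | h2 | h2 | h2 | h2 | h2 | h2 | h2 <;>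
      rw [h2.1, h2.2] at h3 <;> omega
  refine ⟨F, fun γ ↦ if ∃ δ, F.rootLength γ = 2 * F.rootLength δ then 2 else 1, ?_, ?_⟩
  · intro γ; dsimp only; split_ifs <;> simp
  · intro γ δ
    have p1 := F.rootLength_pos γ
    have p2 := F.rootLength_pos δ
    dsimp only
    split_ifs with h1 h2 h2
    · obtain ⟨k, hk⟩ := h1
      obtain ⟨l, hl⟩ := h2
      have t1 := tri δ l
      have t2 := tri γ k
      have t3 := tri δ γ
      have t4 := F.rootLength_pos k
      have t5 := F.rootLength_pos l
      omega
    · obtain ⟨k, hk⟩ := h1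
      rcases tri γ δ with t | t | t
      · exact absurd ⟨k, by omega⟩ h2
      · exact absurd ⟨δ, t⟩ h2
      · omega
    · obtain ⟨k, hk⟩ := h2
      rcases tri δ γ with t | t | t
      · exact absurd ⟨k, by omega⟩ h1
      · exact absurd ⟨γ, t⟩ h1
      · omega
    · rcases tri γ δ with t | t | t
      · rw [t]
      · exact absurd ⟨δ, t⟩ h2
      · exact absurd ⟨γ, t⟩ h1

/-- The bilinear form on coefficient vectors with prescribed lengths of the simple roots. -/
def coordForm {I : Type*} [Fintype I] (C : Matrix I I ℤ) (d : I → ℤ) :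
    LinearMap.BilinForm ℤ (I → ℤ) :=
  LinearMap.mk₂ ℤ (fun v w ↦ ∑ i, v i * (d i * pair C i w))
    (by intros; simp [add_mul, Finset.sum_add_distrib])
    (by intros; simp [Finset.mul_sum, mul_assoc])
    (by intros; simp [mul_add, Finset.sum_add_distrib, pair])
    (by intro a v w
        rw [smul_eq_mul, Finset.mul_sum]
        exact Finset.sum_congr rfl fun i _ ↦ by classical rw [pair_smul]; ring)

lemma coordForm_apply {I : Type*} [Fintype I] (C : Matrix I I ℤ) (d : I → ℤ) (v w : I → ℤ) :
    coordForm C d v w = ∑ i, v i * (d i * pair C i w) := rfl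

/-- Both sides are the invariant form rescaled by 2d divided by the squared length, a factor that
`hd` makes independent of the root. Multiplying by a squared length avoids the division. -/
lemma coordForm_coords (c : Q.Base) (F : Q.RootPositiveForm ℤ) (d : ι → ℤ)
    (hd : ∀ γ δ, F.rootLength γ * d δ = F.rootLength δ * d γ) (γ δ : ι) :
    coordForm c.cartanMatrix.transpose (fun i ↦ d i) (coords c γ) (coords c δ) =
      d δ * Q.pairingIn ℤ γ δ := by
  have hl := F.rootLength_pos δ
  apply mul_left_cancel₀ hl.ne'
  apply FaithfulSMul.algebraMap_injective ℤ K
  have e1 : algebraMap ℤ K (F.rootLength δ * (d δ * Q.pairingIn ℤ γ δ)) =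
      d δ * (2 * F.form (Q.root γ) (Q.root δ)) := by
    rw [F.two_mul_apply_root_root, ← F.algebraMap_rootLength, ← Q.algebraMap_pairingIn ℤ]
    simp only [map_mul, eq_intCast]; ring
  have e2 : ∀ i : c.support, d δ * (2 * F.form (Q.root i) (Q.root δ)) =
      F.rootLength δ * (d i * (Q.pairingIn ℤ δ i : ℤ) : K) := by
    intro i
    have hs : F.form (Q.root i) (Q.root δ) = F.form (Q.root δ) (Q.root i) := by
      rw [← F.symm.eq]; rfl
    have := congrArg (Int.cast (R := K)) (hd i δ)
    push_cast at this
    rw [hs, F.two_mul_apply_root_root, ← F.algebraMap_rootLength, ← Q.algebraMap_pairingIn ℤ]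
    simp only [eq_intCast]
    linear_combination (Q.pairingIn ℤ δ i : K) * this
  rw [e1, coordForm_apply]
  conv_rhs => rw [← combination_coords c γ, combination]
  rw [map_sum, LinearMap.sum_apply, Finset.mul_sum, Finset.mul_sum, Finset.mul_sum,
    map_sum]
  refine Finset.sum_congr rfl fun i _ ↦ ?_
  rw [map_zsmul, LinearMap.smul_apply, zsmul_eq_mul, pair_coords]
  have := e2 i
  simp only [map_mul, eq_intCast]
  linear_combination -(coords c γ i : K) * this

/-- The coefficient vectors of the roots of an irreducible crystallographic reduced root system not
of type `G₂` satisfy the conditions on the coroots. -/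
lemma exists_isCorootSystem (c : Q.Base)
    (hG : ∀ i j, Q.pairingIn ℤ i j ∈ ({-2, -1, 0, 1, 2} : Set ℤ)) :
    ∃ d B, IsCorootSystem c.cartanMatrix.transpose (coordSet c) d B := by
  obtain ⟨F, d, hd, hF⟩ := exists_normalized_length hG
  have hdpos : ∀ γ, 0 < d γ := fun γ ↦ by rcases hd γ with h | h <;> omega
  have key := coordForm_coords c F d hF
  have hself : ∀ γ, coordForm c.cartanMatrix.transpose (fun i : c.support ↦ d i)
      (coords c γ) (coords c γ) = 2 * d γ := by
    intro γ; rw [key, Q.pairingIn_same]; ring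
  have swap : ∀ γ δ, Q.pairingIn ℤ γ δ * d δ = Q.pairingIn ℤ δ γ * d γ := by
    intro γ δ
    have h1 := F.pairingIn_mul_eq_pairingIn_mul_swap γ δ
    have h2 := hF γ δ
    apply mul_left_cancel₀ (F.rootLength_pos γ).ne'
    linear_combination (Q.pairingIn ℤ γ δ) * h2 - d γ * h1
  refine ⟨fun i ↦ d i, coordForm c.cartanMatrix.transpose fun i ↦ d i, ?_⟩
  refine
    { diag := fun i ↦ c.cartanMatrix_apply_same i
      len_simple := fun i ↦ hd i
      symm := ?_, form_unit := ?_
      unit_mem := fun i ↦ ⟨i, (combination_unit c i).symm⟩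
      refl_mem := ?_, nonneg_or := ?_, ne_zero := ?_, form_self := ?_, sub_mem := ?_
      pair_sq_lt := ?_, pair_even := ?_, exists_pair_pos := ?_ }
  · intro v w
    simp only [coordForm_apply, pair, Finset.mul_sum]
    rw [Finset.sum_comm]
    refine Finset.sum_congr rfl fun j _ ↦ Finset.sum_congr rfl fun i _ ↦ ?_
    have := swap i j
    simp only [Matrix.transpose_apply, RootPairing.Base.cartanMatrixIn_def]
    linear_combination -(v i * w j) * this
  · intro i v
    simp [coordForm_apply, unit, Pi.single_apply]
  · intro i v hv
    obtain ⟨γ, rfl⟩ := exists_eq_coords c hv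
    rw [← coords_reflectionPerm]
    exact coords_mem c _
  · intro v hv
    obtain ⟨γ, rfl⟩ := exists_eq_coords c hv
    exact coords_nonneg_or c γ
  · rintro v ⟨γ, hγ⟩ rfl
    exact Q.ne_zero γ (by rw [hγ]; simp [combination])
  · intro v hv
    obtain ⟨γ, rfl⟩ := exists_eq_coords c hv
    rw [hself]
    rcases hd γ with h | h <;> rw [h] <;> simp
  · intro v hv w hw hne hpos
    obtain ⟨γ, rfl⟩ := exists_eq_coords c hv
    obtain ⟨δ, rfl⟩ := exists_eq_coords c hw
    rw [key, mul_pos_iff_of_pos_left (hdpos δ)] at hpos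
    have := Q.root_sub_root_mem_of_pairingIn_pos hpos (fun he ↦ hne (by rw [he]))
    rwa [← combination_coords c, ← combination_coords c, ← combination_sub] at this
  · intro i v hv h1 h2
    obtain ⟨γ, rfl⟩ := exists_eq_coords c hv
    rw [pair_coords, hself]
    have n1 : Q.root γ ≠ Q.root i := fun he ↦ h1 (by
      rw [← coords_simple]; exact eq_coords c (by rw [combination_coords, he]))
    have n2 : Q.root γ ≠ -Q.root i := fun he ↦ h2 (combination_injective c (by
      rw [combination_neg, combination_unit, combination_coords, he]))
    have h3 := Q.pairingIn_pairingIn_mem_set_of_isCrystal_of_isRed' γ i n1 n2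
    have h4 := hG γ i
    have h5 := hG i γ
    have h6 := swap γ i
    have h7 := hdpos γ
    simp only [Set.mem_insert_iff, Set.mem_singleton_iff, Prod.mk.injEq] at h3 h4 h5
    -- For non-proportional roots the product is at most 3, and 3 would need a pairing of absolute
    -- value 3.
    have h8 : Q.pairingIn ℤ γ i * Q.pairingIn ℤ i γ ≤ 2 := by
      rcases h3 with h3 | h3 | h3 | h3 | h3 | h3 | h3 | h3 | h3 | h3 | h3 <;>
        rw [h3.1, h3.2] <;> omega
    have h9 : Q.pairingIn ℤ γ i ^ 2 * d i ≤ 2 * d γ := by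
      calc Q.pairingIn ℤ γ i ^ 2 * d i = (Q.pairingIn ℤ γ i * Q.pairingIn ℤ i γ) * d γ := by
            linear_combination (Q.pairingIn ℤ γ i) * h6
        _ ≤ 2 * d γ := by gcongr
    linarith
  · intro i v hv h1 h2
    obtain ⟨γ, rfl⟩ := exists_eq_coords c hv
    rw [hself] at h1
    rw [pair_coords]
    have h6 := swap γ i
    exact ⟨Q.pairingIn ℤ i γ, by rw [h2, show d γ = 2 by omega] at h6; omega⟩
  · intro v hv h0
    obtain ⟨γ, rfl⟩ := exists_eq_coords c hv
    obtain ⟨j, hj, hp⟩ := ((isPos_iff_coords_nonneg c γ).mpr h0).exists_mem_support_pos_pairingIn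
    refine ⟨⟨j, hj⟩, ?_⟩
    rw [pair_coords]
    exact (Q.zero_lt_pairingIn_iff' ℤ).mp hp

end Length
end Bridge
end Zhelobenko

/-! ### Words and ε-coordinates in types B and C -/

namespace Zhelobenko

section Strings

variable {I : Type*} {n : ℕ}

lemma sortedLT_filter_finRange (p : Fin n → Bool) : ((List.finRange n).filter p).SortedLT :=
  ((List.sortedLT_finRange n).pairwise.filter p).sortedLT

lemma filter_finRange_concat (j i i' : Fin n) (hji : j ≤ i) (hi : i'.val = i.val + 1) :
    (List.finRange n).filter (fun k ↦ j < k ∧ k ≤ i') =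
      (List.finRange n).filter (fun k ↦ j < k ∧ k ≤ i) ++ [i'] := by
  refine (sortedLT_filter_finRange _).eq_of_mem_iff ?_ fun k ↦ ?_
  · rw [List.sortedLT_iff_pairwise, List.pairwise_append]
    refine ⟨(sortedLT_filter_finRange _).pairwise, List.pairwise_singleton _ _, ?_⟩
    intro k hk l hl
    simp only [List.mem_filter, decide_eq_true_eq, List.mem_singleton] at hk hl
    subst hl
    have := hk.2.2
    simp only [Fin.le_def, Fin.lt_def] at this ⊢
    omega
  · simp only [List.mem_filter, List.mem_finRange, decide_eq_true_eq, List.mem_append,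
      List.mem_singleton, true_and, Fin.le_def, Fin.lt_def, Fin.ext_iff] at hji ⊢
    omega

lemma filter_finRange_cons (i i' : Fin n) (hi : i'.val = i.val + 1) :
    (List.finRange n).filter (fun k ↦ i ≤ k ∧ k.val + 1 < n) =
      i :: (List.finRange n).filter (fun k ↦ i' ≤ k ∧ k.val + 1 < n) := by
  refine (sortedLT_filter_finRange _).eq_of_mem_iff ?_ fun k ↦ ?_
  · rw [List.sortedLT_iff_pairwise, List.pairwise_cons]
    refine ⟨?_, (sortedLT_filter_finRange _).pairwise⟩
    intro k hk
    simp only [List.mem_filter, decide_eq_true_eq] at hk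
    have := hk.2.1
    simp only [Fin.le_def, Fin.lt_def] at this ⊢
    omega
  · have := i'.isLt
    simp only [List.mem_filter, List.mem_finRange, decide_eq_true_eq, List.mem_cons,
      true_and, Fin.le_def, Fin.ext_iff]
    omega

variable (C : Matrix I I ℤ) (e : Fin n → I)

lemma down_self (j : Fin n) : down C e j j = gen C (e j) := by
  have : (List.finRange n).filter (fun k ↦ j < k ∧ k ≤ j) = [] := by
    rw [List.filter_eq_nil_iff]
    intro k _
    simp
  rw [down, this]
  rfl

lemma down_succ {j i i' : Fin n} (hji : j ≤ i) (hi : i'.val = i.val + 1) :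
    down C e i' j = op (e i') (down C e i j) := by
  rw [down, filter_finRange_concat j i i' hji hi]
  simp [down, word_cons]

lemma upDown_last {l : Fin n} (hl : l.val + 1 = n) (j : Fin n) :
    upDown C e l j = down C e l j := by
  have h1 : (List.finRange n).filter (fun k ↦ l ≤ k ∧ k.val + 1 < n) = [] := by
    rw [List.filter_eq_nil_iff]
    intro k _
    simp only [decide_eq_true_eq, Fin.le_def]
    omega
  have h2 : (List.finRange n).filter (fun k ↦ j < k) =
      (List.finRange n).filter (fun k ↦ j < k ∧ k ≤ l) := by
    refine List.filter_congr fun k _ ↦ ?_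
    have : k ≤ l := by rw [Fin.le_def]; omega
    simp [this]
  rw [upDown, h1, h2]
  rfl

lemma upDown_succ {i i' : Fin n} (hi : i'.val = i.val + 1) (j : Fin n) :
    upDown C e i j = op (e i) (upDown C e i' j) := by
  rw [upDown, filter_finRange_cons i i' hi]
  simp [upDown, word_cons]

/-- Adjacent labels before the last one are joined by a simple edge, and labels that are not adjacent
are not joined. -/
structure IsSimplyLacedBeforeLast : Prop where
  prod_eq_one : ∀ i j : Fin n, j.val = i.val + 1 → j.val + 1 < n → C (e i) (e j) * C (e j) (e i) = 1
  prod_eq_zero : ∀ i j : Fin n, i.val + 2 ≤ j.val → C (e i) (e j) * C (e j) (e i) = 0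

variable {C e}

namespace IsSimplyLacedBeforeLast

variable (hs : IsSimplyLacedBeforeLast C e)
include hs

/-- At the right end A_{j+1}P_j = A_jP_{j+1}, and A_j commutes with all the higher letters. -/
lemma down_eq_op {j j' : Fin n} (hj : j'.val = j.val + 1) (hj' : j'.val + 1 < n) :
    ∀ m (i : Fin n), i.val = m → j' ≤ i → down C e i j = op (e j) (down C e i j') := by
  intro m
  induction m with
  | zero => intro i hi h; rw [Fin.le_def] at h; omega
  | succ m ih =>
    intro i hi h
    obtain rfl | hne := eq_or_ne i j'
    · rw [down_self, down_succ C e le_rfl hj, down_self, op_gen_swap]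
      rw [mul_comm]
      exact hs.prod_eq_one j i hj hj'
    · have h1 : j'.val < i.val := lt_of_le_of_ne h fun h ↦ hne (Fin.ext h.symm)
      have h2 : j' ≤ (⟨m, by omega⟩ : Fin n) := by rw [Fin.le_def]; simp only; omega
      have h3 : j ≤ (⟨m, by omega⟩ : Fin n) := by rw [Fin.le_def] at *; simp only at *; omega
      rw [down_succ C e h3 hi, ih ⟨m, by omega⟩ rfl h2, down_succ C e h2 hi]
      exact (op_comm (hs.prod_eq_zero j i (by omega)) _).symm

/-- The letters of the ascending part have labels at least j + 2, so A_j moves through them. -/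
lemma upDown_eq_op {j j' : Fin n} (hj : j'.val = j.val + 1) :
    ∀ m (i : Fin n), i.val + 1 + m = n → j' < i → upDown C e i j = op (e j) (upDown C e i j') := by
  intro m
  induction m with
  | zero =>
    intro i hi h
    rw [Fin.lt_def] at h
    rw [upDown_last C e hi, upDown_last C e hi]
    exact hs.down_eq_op hj (by omega) _ i rfl h.le
  | succ m ih =>
    intro i hi h
    rw [Fin.lt_def] at h
    have h1 : j' < (⟨i.val + 1, by omega⟩ : Fin n) := by rw [Fin.lt_def]; simp only; omega
    rw [upDown_succ C e (i' := ⟨i.val + 1, by omega⟩) rfl, ih _ (by simp only; omega) h1,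
      upDown_succ C e (i := i) (i' := ⟨i.val + 1, by omega⟩) rfl]
    exact (op_comm (hs.prod_eq_zero j i (by omega)) _).symm

end IsSimplyLacedBeforeLast

end Strings

section Relation

variable {I K N : Type*} [Field K] [AddCommGroup N] [Module K N] {n : ℕ}

/-- A relation between the vectors of a root system `S` with simple roots `a` and pairings `f` and
the elements of the pointed monoid that is compatible with the operators. -/
structure IsCompatible (C : Matrix I I ℤ) (S : Set N) (a : I → N) (f : I → N →ₗ[K] K)
    (J : N → PointedMonoid C → Prop) : Prop where
  simple : ∀ k, J (a k) (gen C k)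
  mem : ∀ v x, J v x → v ∈ S
  refl_mem : ∀ k, ∀ v ∈ S, v - f k v • a k ∈ S
  self : ∀ k, f k (a k) = 2
  add : ∀ k v x, J v x → f k v = -1 → J (v + a k) (op k x)
  add_of_mem : ∀ k v x, J v x → v + a k ∈ S → v - a k ∈ S → J (v + a k) (op k x)

/-- The vectors `ε_i` in types `B` and `C`; the value of the last pairing on the last vector
is `c`. -/
structure IsEpsilonBasis (a : I → N) (f : I → N →ₗ[K] K) (e : Fin n → I) (ε : Fin n → N)
    (c : K) : Prop where
  simple : ∀ i j : Fin n, j.val = i.val + 1 → a (e i) = ε i - ε j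
  pairing : ∀ k i : Fin n, f (e k) (ε i) =
    (if i.val = k.val then (if k.val + 1 = n then c else 1) else 0) -
      (if i.val = k.val + 1 then 1 else 0)

variable {C : Matrix I I ℤ} {S : Set N} {a : I → N} {f : I → N →ₗ[K] K}
  {J : N → PointedMonoid C → Prop} {e : Fin n → I} {ε : Fin n → N} {c : K}

namespace IsEpsilonBasis

variable (hε : IsEpsilonBasis a f e ε c)
include hε

lemma pairing_zero {k i : Fin n} (h1 : i.val ≠ k.val) (h2 : i.val ≠ k.val + 1) :
    f (e k) (ε i) = 0 := by
  rw [hε.pairing, if_neg h1, if_neg h2, sub_zero]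

lemma pairing_same {k : Fin n} (h : k.val + 1 < n) : f (e k) (ε k) = 1 := by
  rw [hε.pairing, if_pos rfl, if_neg h.ne, if_neg (by omega), sub_zero]

lemma pairing_last {k : Fin n} (h : k.val + 1 = n) : f (e k) (ε k) = c := by
  rw [hε.pairing, if_pos rfl, if_pos h, if_neg (by omega), sub_zero]

lemma pairing_succ {k i : Fin n} (h : i.val = k.val + 1) : f (e k) (ε i) = -1 := by
  rw [hε.pairing, if_neg (by omega), if_pos h, zero_sub]

end IsEpsilonBasis

namespace IsCompatible

variable (hJ : IsCompatible C S a f J)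
include hJ

/-- The reflection exchanges the two ends of the string, so one end suffices. -/
lemma add_of_pairing_eq_zero {k : I} {v : N} {x : PointedMonoid C} (hv : J v x) (h0 : f k v = 0)
    (hm : v - a k ∈ S) : J (v + a k) (op k x) := by
  refine hJ.add_of_mem k v x hv ?_ hm
  have := hJ.refl_mem k _ hm
  rw [map_sub, h0, hJ.self] at this
  convert this using 1
  module

variable (hε : IsEpsilonBasis a f e ε c)
include hε

lemma down {j : Fin n} : ∀ m (i k : Fin n), i.val = j.val + m → k.val = i.val + 1 →
    J (ε j - ε k) (down C e i j) := by
  intro m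
  induction m with
  | zero =>
    intro i k hi hk
    obtain rfl : i = j := Fin.ext hi
    rw [down_self, ← hε.simple i k hk]
    exact hJ.simple _
  | succ m ih =>
    intro i k hi hk
    have h1 := ih ⟨j.val + m, by omega⟩ i rfl hi
    rw [down_succ C e (i := ⟨j.val + m, by omega⟩) (Fin.le_def.mpr (by simp)) hi]
    have h2 := hJ.add (e i) _ _ h1 (by
      rw [map_sub, hε.pairing_same (by omega), hε.pairing_zero (by omega) (by omega), zero_sub])
    rw [hε.simple i k hk] at h2
    convert h2 using 1
    abel

/-- Adding α_i^∨ = ε_i - ε_{i+1} replaces ε_{i+1} by ε_i. -/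
lemma upDown_step {i i' : Fin n} (hi : i'.val = i.val + 1) {v : N} {k : Fin n}
    (h : J (ε i' + v) (upDown C e i' k)) (hv : f (e i) v = 0) :
    J (ε i + v) (upDown C e i k) := by
  rw [upDown_succ C e hi]
  have h2 := hJ.add (e i) _ _ h (by rw [map_add, hv, hε.pairing_succ hi, add_zero])
  rw [hε.simple i i' hi] at h2
  convert h2 using 1
  abel

section TypeB

/-- Provides the lower end of the α_i-string 2ε_{i+1}, ε_i + ε_{i+1}, 2ε_i. -/
lemma two_epsilon_mem (hl : ∀ i : Fin n, i.val + 1 = n → a (e i) = (2 : ℕ) • ε i) :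
    ∀ m (i : Fin n), i.val + 1 + m = n → ε i + ε i ∈ S := by
  intro m
  induction m with
  | zero =>
    intro i hi
    rw [← two_nsmul, ← hl i hi]
    exact hJ.mem _ _ (hJ.simple _)
  | succ m ih =>
    intro i hi
    have h1 := hJ.refl_mem (e i) _ (ih ⟨i.val + 1, by omega⟩ (by simp only; omega))
    rw [map_add, hε.pairing_succ rfl, hε.simple i ⟨i.val + 1, by omega⟩ rfl] at h1
    convert h1 using 1
    module

lemma upDown_typeB (hc : c = 1) (hl : ∀ i : Fin n, i.val + 1 = n → a (e i) = (2 : ℕ) • ε i)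
    {j : Fin n} : ∀ m (i : Fin n), i.val + 1 + m = n → j ≤ i → J (ε j + ε i) (upDown C e i j) := by
  intro m
  induction m with
  | zero =>
    intro i hi hji
    rw [upDown_last C e hi]
    obtain rfl | hne := eq_or_ne i j
    · rw [down_self, ← two_nsmul, ← hl i hi]
      exact hJ.simple _
    · have h1 : j.val < i.val := lt_of_le_of_ne hji fun h ↦ hne (Fin.ext h.symm)
      have h2 := hJ.down hε (j := j) (i.val - 1 - j.val) ⟨i.val - 1, by omega⟩ i
        (by simp only; omega) (by simp only; omega)
      rw [down_succ C e (i := ⟨i.val - 1, by omega⟩) (Fin.le_def.mpr (by simp only; omega))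
        (by simp only; omega)]
      have h3 := hJ.add (e i) _ _ h2 (by
        rw [map_sub, hε.pairing_last hi, hε.pairing_zero (by omega) (by omega), hc, zero_sub])
      rw [hl i hi] at h3
      convert h3 using 1
      module
  | succ m ih =>
    intro i hi hji
    have hi' : (⟨i.val + 1, by omega⟩ : Fin n).val = i.val + 1 := rfl
    generalize (⟨i.val + 1, by omega⟩ : Fin n) = i' at hi'
    have h1 := ih i' (by omega) (Fin.le_def.mpr (by rw [Fin.le_def] at hji; omega))
    obtain rfl | hne := eq_or_ne i j
    -- Here ε_i + ε_{i+1} is the middle of its α_i-string, so the step to 2ε_i is not a reflection.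
    · rw [upDown_succ C e hi']
      have h2 := hJ.add_of_pairing_eq_zero (k := e i) h1 (by
        rw [map_add, hε.pairing_same (by omega), hε.pairing_succ hi', add_neg_cancel]) (by
        rw [hε.simple i i' hi']
        convert hJ.two_epsilon_mem hε hl m i' (by omega) using 1
        abel)
      rw [hε.simple i i' hi'] at h2
      convert h2 using 1
      abel
    · have h3 : j.val < i.val := lt_of_le_of_ne hji fun h ↦ hne (Fin.ext h.symm)
      rw [add_comm] at h1 ⊢
      exact hJ.upDown_step hε hi' h1 (hε.pairing_zero (by omega) (by omega))

end TypeB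

section TypeC

lemma upDown_epsilon (hl : ∀ i : Fin n, i.val + 1 = n → a (e i) = ε i) {l : Fin n}
    (hln : l.val + 1 = n) :
    ∀ m (i : Fin n), i.val + 1 + m = n → J (ε i) (upDown C e i l) := by
  intro m
  induction m with
  | zero =>
    intro i hi
    obtain rfl : i = l := Fin.ext (by omega)
    rw [upDown_last C e hi, down_self, ← hl i hi]
    exact hJ.simple _
  | succ m ih =>
    intro i hi
    have h1 := ih ⟨i.val + 1, by omega⟩ (by simp only; omega)
    rw [← add_zero (ε _)] at h1 ⊢
    exact hJ.upDown_step hε rfl h1 (map_zero _)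

/-- Descending induction on k. Adding α_k^∨ and then α_{k+1}^∨ to ε_{k+1} + ε_{k+2} gives ε_k +
ε_{k+1}, with word A_{k+1}A_k[k+1,n,k+1]. A braid relation, with A_k pulled out by `upDown_eq_op`,
identifies it with [k,n,k]. At the last node the double-bond relation A_nA_{n-1}P_n =
A_{n-1}A_nP_{n-1} starts the induction. -/
lemma upDown_adjacent (hs : IsSimplyLacedBeforeLast C e)
    (hs2 : ∀ i j : Fin n, j.val = i.val + 1 → j.val + 1 = n → C (e i) (e j) * C (e j) (e i) = 2)
    (hl : ∀ i : Fin n, i.val + 1 = n → a (e i) = ε i) :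
    ∀ m (k k' : Fin n), k'.val = k.val + 1 → k'.val + 1 + m = n →
      J (ε k + ε k') (upDown C e k k) := by
  intro m
  induction m with
  | zero =>
    intro k k' hk hkn
    have h1 := hJ.upDown_epsilon hε hl hkn 1 k (by omega)
    have h2 := hJ.add_of_pairing_eq_zero (k := e k') h1 (hε.pairing_zero (by omega) (by omega)) (by
      rw [hl k' hkn, ← hε.simple k k' hk]
      exact hJ.mem _ _ (hJ.simple _))
    rw [hl k' hkn] at h2
    convert h2 using 1
    rw [upDown_succ C e hk, upDown_last C e hkn, down_succ C e le_rfl hk, down_self,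
      upDown_succ C e hk, upDown_last C e hkn, down_self]
    exact op_op_gen_swap (by rw [mul_comm]; exact hs2 k k' hk hkn)
  | succ m ih =>
    intro k k' hk hkn
    have hk'' : (⟨k'.val + 1, by omega⟩ : Fin n).val = k'.val + 1 := rfl
    generalize (⟨k'.val + 1, by omega⟩ : Fin n) = k'' at hk''
    have h1 := ih k' k'' hk'' (by omega)
    have h2 := hJ.add (e k) _ _ h1 (by
      rw [map_add, hε.pairing_succ hk, hε.pairing_zero (by omega) (by omega), add_zero])
    have h3 := hJ.add (e k') _ _ h2 (by
      rw [hε.simple k k' hk, map_add, map_add, map_sub, hε.pairing_succ hk'',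
        hε.pairing_same (by omega), hε.pairing_zero (by omega) (by omega)]
      ring)
    rw [hε.simple k k' hk, hε.simple k' k'' hk''] at h3
    convert h3 using 1
    · abel
    · rw [upDown_succ C e hk, upDown_succ C e hk'',
        hs.upDown_eq_op hk (n - (k''.val + 1)) k'' (by omega) (Fin.lt_def.mpr (by omega)),
        upDown_succ C e hk'' k']
      exact op_braid₁ (hs.prod_eq_one k k' hk (by omega)) _

lemma upDown_typeC (hs : IsSimplyLacedBeforeLast C e)
    (hs2 : ∀ i j : Fin n, j.val = i.val + 1 → j.val + 1 = n → C (e i) (e j) * C (e j) (e i) = 2)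
    (hl : ∀ i : Fin n, i.val + 1 = n → a (e i) = ε i) {k k' : Fin n} (hk : k'.val = k.val + 1) :
    ∀ m (i : Fin n), i.val + m = k.val → J (ε i + ε k') (upDown C e i k) := by
  intro m
  induction m with
  | zero =>
    intro i hi
    obtain rfl : i = k := Fin.ext (by omega)
    exact hJ.upDown_adjacent hε hs hs2 hl (n - (k'.val + 1)) i k' hk (by omega)
  | succ m ih =>
    intro i hi
    have h1 := ih ⟨i.val + 1, by omega⟩ (by simp only; omega)
    exact hJ.upDown_step hε rfl h1 (hε.pairing_zero (by omega) (by omega))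

end TypeC

end IsCompatible

section EpsilonBasis

variable [CharZero K]

/-- Since ε_i = α_i^∨ + ε_{i+1}, all pairings follow downwards from those of the last vector. -/
lemma isEpsilonBasis_of_pairing_last
    (hsub : ∀ i j : Fin n, j.val = i.val + 1 → a (e i) = ε i - ε j)
    (hlast : ∀ k i : Fin n, i.val + 1 = n → f (e k) (ε i) =
      (if i.val = k.val then c else 0) - (if i.val = k.val + 1 then 1 else 0))
    (hpair : ∀ k i : Fin n, i.val + 1 < n → f (e k) (a (e i)) =
      (if i.val = k.val then 2 else 0) - (if i.val = k.val + 1 then 1 else 0) -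
        (if k.val = i.val + 1 then (if k.val + 1 = n then c else 1) else 0)) :
    IsEpsilonBasis a f e ε c := by
  refine ⟨hsub, fun k i ↦ ?_⟩
  obtain ⟨m, hm⟩ : ∃ m, i.val + 1 + m = n := ⟨n - (i.val + 1), by omega⟩
  induction m generalizing i with
  | zero =>
    rw [hlast k i hm]
    congr 1
    by_cases h : i.val = k.val
    · rw [if_pos h, if_pos h, if_pos (by omega)]
    · rw [if_neg h, if_neg h]
  | succ m ih =>
    have h1 := ih ⟨i.val + 1, by omega⟩ (by simp only; omega)
    have h2 := hpair k i (by omega)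
    rw [hsub i ⟨i.val + 1, by omega⟩ rfl, map_sub, h1] at h2
    rw [sub_eq_iff_eq_add] at h2
    rw [h2]
    simp only
    split_ifs <;> first | omega | ring

end EpsilonBasis

end Relation

end Zhelobenko

/-! ### Application to coroots, viewed as the roots of the flipped pairing -/

namespace Zhelobenko

section Coroots

variable {ι K M N : Type*} [Finite ι] [Field K] [CharZero K] [AddCommGroup M] [Module K M]
  [AddCommGroup N] [Module K N] {P : RootPairing ι K M N} [P.IsCrystallographic]

/-- The coefficients of a coroot with respect to the simple coroots. -/
noncomputable def corootCoords (b : P.Base) (γ : ι) : b.support → ℤ := coords b.flip γ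

/-- The coefficient vectors of the coroots. -/
def corootSet (b : P.Base) : Set (b.support → ℤ) := coordSet b.flip

/-- The integral combination of simple coroots with the given coefficients. -/
def corootCombination (b : P.Base) (v : b.support → ℤ) : N := combination b.flip v

lemma corootCombination_corootCoords (b : P.Base) (γ : ι) :
    corootCombination b (corootCoords b γ) = P.coroot γ := combination_coords b.flip γ

lemma corootCombination_add (b : P.Base) (v w : b.support → ℤ) :
    corootCombination b (v + w) = corootCombination b v + corootCombination b w :=
  combination_add b.flip v w

lemma corootCombination_sub (b : P.Base) (v w : b.support → ℤ) :
    corootCombination b (v - w) = corootCombination b v - corootCombination b w :=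
  combination_sub b.flip v w

lemma eq_corootCoords (b : P.Base) {v : b.support → ℤ} {γ : ι}
    (h : corootCombination b v = P.coroot γ) : v = corootCoords b γ := eq_coords b.flip h

lemma corootCoords_mem (b : P.Base) (γ : ι) : corootCoords b γ ∈ corootSet b := coords_mem b.flip γ

lemma mem_corootSet {b : P.Base} {v : b.support → ℤ} :
    v ∈ corootSet b ↔ ∃ γ, P.coroot γ = corootCombination b v := Iff.rfl

lemma pairingIn_flip (i j : ι) : P.flip.pairingIn ℤ i j = P.pairingIn ℤ j i := by
  apply FaithfulSMul.algebraMap_injective ℤ K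
  rw [P.flip.algebraMap_pairingIn, P.algebraMap_pairingIn, P.pairing_flip]

lemma transpose_cartanMatrix_flip (b : P.Base) :
    (b.flip.cartanMatrix.transpose : Matrix b.support b.support ℤ) = b.cartanMatrix := by
  ext i j
  exact pairingIn_flip _ _

/-- Induction through simple reflections: s_j permutes the positive indices other than j, for roots
and for coroots alike. -/
lemma isPos_flip_of_isPos [P.IsReduced] (b : P.Base) {γ : ι} (h : b.IsPos γ) :
    b.flip.IsPos γ := by
  let := P.indexNeg
  have key : b.IsPos γ → b.flip.IsPos γ := by
    refine h.induction_on_reflect (p := fun γ ↦ b.IsPos γ → b.flip.IsPos γ) ?_ ?_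
    · intro i hi _
      exact b.flip.isPos_of_mem_support hi
    · intro i j ih hj hp
      by_cases h1 : P.reflectionPerm j i = j
      · rw [h1]
        exact b.flip.isPos_of_mem_support hj
      · have h2 : i ≠ j := by
          rintro rfl
          exact (RootPairing.Base.IsPos.neg_iff_not b i).mp hp (b.isPos_of_mem_support hj)
        have h3 := hp.reflectionPerm hj h1
        rw [P.reflectionPerm_self] at h3
        exact (ih h3).reflectionPerm (b := b.flip) hj h2
  exact key h

lemma isPos_iff_corootCoords_nonneg [P.IsReduced] (b : P.Base) (γ : ι) :
    b.IsPos γ ↔ 0 ≤ corootCoords b γ := by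
  refine Iff.trans ⟨isPos_flip_of_isPos b, fun h ↦ ?_⟩ (isPos_iff_coords_nonneg b.flip γ)
  exact isPos_flip_of_isPos b.flip h

lemma height_flip_eq_ht (b : P.Base) (γ : ι) : b.flip.height γ = ht (corootCoords b γ) :=
  height_eq_ht b.flip γ

lemma coroot_reflectionPerm_of_pairingIn {i γ : ι} (h : P.pairingIn ℤ i γ = -1) :
    P.coroot (P.reflectionPerm i γ) = P.coroot γ + P.coroot i := by
  rw [P.coroot_reflectionPerm, P.coreflection_apply_coroot, ← P.algebraMap_pairingIn ℤ, h]
  simp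

variable [DecidableEq ι]

lemma corootCombination_unit (b : P.Base) (i : b.support) :
    corootCombination b (unit i) = P.coroot i := combination_unit b.flip i

lemma pair_corootCoords (b : P.Base) (γ : ι) (i : b.support) :
    pair b.cartanMatrix i (corootCoords b γ) = P.pairingIn ℤ i γ := by
  rw [← transpose_cartanMatrix_flip, ← pairingIn_flip]
  exact pair_coords b.flip γ i

lemma corootCoords_simple (b : P.Base) (i : b.support) : corootCoords b i = unit i :=
  coords_simple b.flip i

variable [P.IsReduced] [P.IsIrreducible]

lemma exists_isCorootSystem_corootSet (b : P.Base)
    (hG : ∀ i j, P.pairingIn ℤ i j ∈ ({-2, -1, 0, 1, 2} : Set ℤ)) :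
    ∃ d B, IsCorootSystem b.cartanMatrix (corootSet b) d B := by
  rw [← transpose_cartanMatrix_flip]
  exact exists_isCorootSystem b.flip fun i j ↦ by rw [pairingIn_flip]; exact hG j i

/-- The element of the Zhelobenko monoid attached to a coroot. -/
noncomputable def corootElt (b : P.Base) (γ : ι) : PointedMonoid b.cartanMatrix :=
  elt b.cartanMatrix (corootSet b) (corootCoords b γ)

section Properties

variable {b : P.Base} (hG : ∀ i j, P.pairingIn ℤ i j ∈ ({-2, -1, 0, 1, 2} : Set ℤ))
include hG

lemma corootCoords_pos {γ : ι} (h : b.IsPos γ) :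
    corootCoords b γ ∈ corootSet b ∧ 0 ≤ corootCoords b γ :=
  ⟨corootCoords_mem b γ, (isPos_iff_corootCoords_nonneg b γ).mp h⟩

lemma corootElt_ne_zero {γ : ι} (h : b.IsPos γ) : corootElt b γ ≠ 0 := by
  obtain ⟨d, B, hR⟩ := exists_isCorootSystem_corootSet b hG
  exact hR.elt_ne_zero (corootCoords_pos hG h)

lemma corootElt_injective {γ δ : ι} (hγ : b.IsPos γ) (hδ : b.IsPos δ)
    (h : corootElt b γ = corootElt b δ) : γ = δ := by
  obtain ⟨d, B, hR⟩ := exists_isCorootSystem_corootSet b hG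
  have h1 := hR.elt_injective (corootCoords_pos hG hγ) (corootCoords_pos hG hδ) h
  apply P.coroot.injective
  rw [← corootCombination_corootCoords b γ, h1, corootCombination_corootCoords]

lemma corootElt_simple (i : b.support) : corootElt b i = gen _ i := by
  obtain ⟨d, B, hR⟩ := exists_isCorootSystem_corootSet b hG
  rw [corootElt, corootCoords_simple]
  exact hR.elt_unit i

lemma length_of_word_eq_corootElt {γ : ι} (hγ : b.IsPos γ) {u : List b.support} {k : b.support}
    (h : word _ u k = corootElt b γ) : (u.length : ℤ) + 1 = b.flip.height γ := by
  obtain ⟨d, B, hR⟩ := exists_isCorootSystem_corootSet b hG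
  obtain ⟨u', k', h1, h2⟩ := hR.exists_word (corootCoords_pos hG hγ)
  rw [height_flip_eq_ht, ← h2, length_eq_of_word_eq (h.trans h1)
    (h ▸ corootElt_ne_zero hG hγ)]

/-- The common source of (b), with pairing -1, and of (c), with pairing 0. -/
lemma op_corootElt_of_coroot_add {γ δ : ι} {i : b.support} (hγ : b.IsPos γ)
    (hp : -1 ≤ P.pairingIn ℤ i γ) (h : P.coroot δ = P.coroot γ + P.coroot i) :
    b.IsPos δ ∧ op i (corootElt b γ) = corootElt b δ := by
  obtain ⟨d, B, hR⟩ := exists_isCorootSystem_corootSet b hG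
  have h1 : corootCoords b γ + unit i = corootCoords b δ := eq_corootCoords b (by
    rw [corootCombination_add, corootCombination_corootCoords, corootCombination_unit, h])
  have h2 := hR.add_unit_nonneg (i := i) (corootCoords_pos hG hγ)
    (h1 ▸ corootCoords_mem b δ)
  refine ⟨(isPos_iff_corootCoords_nonneg b δ).mpr (h1 ▸ h2.2), ?_⟩
  rw [corootElt, corootElt, ← h1]
  exact (hR.elt_add (corootCoords_pos hG hγ) h2.1 (by rwa [pair_corootCoords])).symm

lemma pairingIn_eq_zero_of_middle {γ δ δ' : ι} {i : b.support}
    (h : P.coroot δ = P.coroot γ + P.coroot i) (h' : P.coroot δ' = P.coroot γ - P.coroot i) :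
    P.pairingIn ℤ i γ = 0 := by
  obtain ⟨d, B, hR⟩ := exists_isCorootSystem_corootSet b hG
  rw [← pair_corootCoords b γ i]
  apply hR.pair_eq_zero_of_middle
  · rw [mem_corootSet, corootCombination_add, corootCombination_corootCoords,
      corootCombination_unit]
    exact ⟨δ, h⟩
  · rw [mem_corootSet, corootCombination_sub, corootCombination_corootCoords,
      corootCombination_unit]
    exact ⟨δ', h'⟩

lemma op_corootElt_eq_zero {γ : ι} {i : b.support} (hγ : b.IsPos γ)
    (h : ¬ ∃ δ, P.coroot δ = P.coroot γ + P.coroot i) : op i (corootElt b γ) = 0 := by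
  obtain ⟨d, B, hR⟩ := exists_isCorootSystem_corootSet b hG
  apply hR.op_elt_eq_zero (corootCoords_pos hG hγ)
  rwa [mem_corootSet, corootCombination_add, corootCombination_corootCoords,
    corootCombination_unit]

/-- The relation between positive coroots and their elements. -/
lemma isCompatible_corootElt :
    IsCompatible b.cartanMatrix (Set.range P.coroot) (fun k : b.support ↦ P.coroot k)
      (fun k : b.support ↦ P.root' k)
      (fun v x ↦ ∃ γ, b.IsPos γ ∧ P.coroot γ = v ∧ corootElt b γ = x) where
  simple k := ⟨k, b.isPos_of_mem_support k.2, rfl, corootElt_simple hG k⟩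
  mem := by
    rintro v x ⟨γ, -, rfl, -⟩
    exact ⟨γ, rfl⟩
  refl_mem := by
    rintro k v ⟨γ, rfl⟩
    exact ⟨P.reflectionPerm k γ, by rw [P.coroot_reflectionPerm, P.coreflection_apply]⟩
  self k := P.root_coroot_two k
  add := by
    rintro k v x ⟨γ, hγ, rfl, rfl⟩ h
    have h1 : P.pairingIn ℤ k γ = -1 := by
      apply FaithfulSMul.algebraMap_injective ℤ K
      rw [P.algebraMap_pairingIn, ← P.root_coroot_eq_pairing]
      simpa using h
    have h2 := coroot_reflectionPerm_of_pairingIn h1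
    obtain ⟨h3, h4⟩ := op_corootElt_of_coroot_add hG hγ h1.ge h2
    exact ⟨_, h3, h2, h4.symm⟩
  add_of_mem := by
    rintro k v x ⟨γ, hγ, rfl, rfl⟩ ⟨δ, h⟩ ⟨δ', h'⟩
    obtain ⟨h3, h4⟩ := op_corootElt_of_coroot_add hG hγ
      (by rw [pairingIn_eq_zero_of_middle hG h h']; norm_num) h
    exact ⟨_, h3, h, h4.symm⟩

end Properties

lemma root'_coroot_eq_cartanMatrix (b : P.Base) (i j : b.support) :
    P.root' i (P.coroot j) = (b.cartanMatrix i j : K) := by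
  have := P.algebraMap_pairingIn ℤ i j
  rw [← P.root_coroot_eq_pairing] at this
  exact this.symm

variable {b : P.Base} {n : ℕ} {e : Fin n → b.support} {ε : Fin n → N}

lemma isEpsilonBasis_typeB (hC : ∀ i j, b.cartanMatrix (e i) (e j) = CartanMatrix.B n i j)
    (hsub : ∀ i j : Fin n, j.val = i.val + 1 → P.coroot (e i) = ε i - ε j)
    (hlast : ∀ i : Fin n, i.val + 1 = n → P.coroot (e i) = (2 : ℕ) • ε i) :
    IsEpsilonBasis (fun k : b.support ↦ P.coroot k) (fun k : b.support ↦ P.root' k) e ε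
      (1 : K) := by
  refine isEpsilonBasis_of_pairing_last hsub (fun k i hi ↦ ?_) fun k i hi ↦ ?_
  · have h1 := root'_coroot_eq_cartanMatrix b (e k) (e i)
    rw [hlast i hi, map_nsmul, hC] at h1
    apply mul_left_cancel₀ (two_ne_zero (α := K))
    rw [two_nsmul, ← two_mul] at h1
    refine h1.trans ?_
    simp only [CartanMatrix.B, Matrix.of_apply, Fin.ext_iff]
    split_ifs <;> first | omega | norm_num
  · rw [root'_coroot_eq_cartanMatrix, hC]
    simp only [CartanMatrix.B, Matrix.of_apply, Fin.ext_iff]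
    split_ifs <;> first | omega | norm_num

lemma isEpsilonBasis_typeC (hC : ∀ i j, b.cartanMatrix (e i) (e j) = CartanMatrix.C n i j)
    (hsub : ∀ i j : Fin n, j.val = i.val + 1 → P.coroot (e i) = ε i - ε j)
    (hlast : ∀ i : Fin n, i.val + 1 = n → P.coroot (e i) = ε i) :
    IsEpsilonBasis (fun k : b.support ↦ P.coroot k) (fun k : b.support ↦ P.root' k) e ε
      (2 : K) := by
  refine isEpsilonBasis_of_pairing_last hsub (fun k i hi ↦ ?_) fun k i hi ↦ ?_
  · rw [← hlast i hi, root'_coroot_eq_cartanMatrix, hC]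
    simp only [CartanMatrix.C, Matrix.of_apply, Fin.ext_iff]
    split_ifs <;> first | omega | norm_num
  · rw [root'_coroot_eq_cartanMatrix, hC]
    simp only [CartanMatrix.C, Matrix.of_apply, Fin.ext_iff]
    split_ifs <;> first | omega | norm_num

end Coroots

end Zhelobenko

/-! ### The theorem for simple Lie algebras -/

open LieAlgebra.IsKilling in
theorem lemma6p7 {K L : Type*} [Field K] [IsAlgClosed K] [CharZero K]
    [LieRing L] [LieAlgebra K L] [FiniteDimensional K L] [LieAlgebra.IsSimple K L]
    (H : LieSubalgebra K L) [H.IsCartanSubalgebra]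
    (hG₂ : ¬ (rootSystem H).IsG2)
    (b : (rootSystem H).Base) :
    ∃ Φ : Zhelobenko.PosCoroot b → Zhelobenko.Elt b.cartanMatrix,
      Function.Injective Φ ∧
      -- `Φ(α^∨) = P_α` for every simple root `α`
      (∀ (α : b.support) (γ : Zhelobenko.PosCoroot b), γ.1 = α.1 →
        (Φ γ).1 = Zhelobenko.word _ [] α) ∧
      -- the length of `Φ(γ^∨)` is the height of the coroot `γ^∨`
      (∀ (γ : Zhelobenko.PosCoroot b) (u : List b.support) (α : b.support),
        Zhelobenko.word _ u α = (Φ γ).1 → (u.length : ℤ) + 1 = b.flip.height γ.1) ∧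
      -- if `α(γ^∨) = -1` and `A_α Φ(γ^∨)` is in the image of `Φ`, then it is `Φ(s_α γ^∨)`
      (∀ (α : b.support) (γ : Zhelobenko.PosCoroot b),
        (rootSystem H).pairingIn ℤ α γ = -1 →
        (∃ δ, Zhelobenko.op α (Φ γ).1 = (Φ δ).1) →
        ∃ δ : Zhelobenko.PosCoroot b, δ.1 = (rootSystem H).reflectionPerm α γ ∧
          Zhelobenko.op α (Φ γ).1 = (Φ δ).1) ∧
      -- if `α(γ^∨) = -1`, then `A_α Φ(γ^∨)` is in the image of `Φ`
      (∀ (α : b.support) (γ : Zhelobenko.PosCoroot b),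
        (rootSystem H).pairingIn ℤ α γ = -1 →
        ∃ δ, Zhelobenko.op α (Φ γ).1 = (Φ δ).1) ∧
      -- if `γ^∨ + α^∨` and `γ^∨ - α^∨` are coroots, then `A_α Φ(γ^∨) = Φ(α^∨ + γ^∨)`
      (∀ (α : b.support) (γ : Zhelobenko.PosCoroot b),
        (∃ δ, (rootSystem H).coroot δ = (rootSystem H).coroot γ + (rootSystem H).coroot α) →
        (∃ δ, (rootSystem H).coroot δ = (rootSystem H).coroot γ - (rootSystem H).coroot α) →
        ∃ δ : Zhelobenko.PosCoroot b,
          (rootSystem H).coroot δ = (rootSystem H).coroot α + (rootSystem H).coroot γ ∧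
          Zhelobenko.op α (Φ γ).1 = (Φ δ).1) ∧
      -- if neither `γ^∨ + α^∨` nor `γ^∨ - α^∨` is a coroot, then `A_α Φ(γ^∨) = 0`
      (∀ (α : b.support) (γ : Zhelobenko.PosCoroot b),
        (¬ ∃ δ, (rootSystem H).coroot δ = (rootSystem H).coroot γ + (rootSystem H).coroot α) →
        (¬ ∃ δ, (rootSystem H).coroot δ = (rootSystem H).coroot γ - (rootSystem H).coroot α) →
        Zhelobenko.op α (Φ γ).1 = 0) ∧
      -- the explicit description of `Φ` in types `B_n` and `C_n`
      Zhelobenko.IsStandardB b Φ ∧ Zhelobenko.IsStandardC b Φ := by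
  classical
  have hG : ∀ i j, (rootSystem H).pairingIn ℤ i j ∈ ({-2, -1, 0, 1, 2} : Set ℤ) :=
    (RootPairing.isNotG2_iff _).mp ((RootPairing.not_isG2_iff_isNotG2 _).mp hG₂)
  refine ⟨fun γ ↦ ⟨Zhelobenko.corootElt b γ, Zhelobenko.corootElt_ne_zero hG γ.2⟩, ?_, ?_, ?_, ?_,
    ?_, ?_, ?_, ?_, ?_⟩
  · intro γ δ h
    exact Subtype.ext (Zhelobenko.corootElt_injective hG γ.2 δ.2 (congrArg Subtype.val h))
  · rintro α ⟨γ, hγ⟩ rfl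
    exact Zhelobenko.corootElt_simple hG α
  · intro γ u α h
    exact Zhelobenko.length_of_word_eq_corootElt hG γ.2 h
  · intro α γ h _
    obtain ⟨h1, h2⟩ := Zhelobenko.op_corootElt_of_coroot_add hG γ.2 h.ge
      (Zhelobenko.coroot_reflectionPerm_of_pairingIn h)
    exact ⟨⟨_, h1⟩, rfl, h2⟩
  · intro α γ h
    obtain ⟨h1, h2⟩ := Zhelobenko.op_corootElt_of_coroot_add hG γ.2 h.ge
      (Zhelobenko.coroot_reflectionPerm_of_pairingIn h)
    exact ⟨⟨_, h1⟩, h2⟩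
  · rintro α γ ⟨δ, hδ⟩ ⟨δ', hδ'⟩
    obtain ⟨h1, h2⟩ := Zhelobenko.op_corootElt_of_coroot_add hG γ.2
      (by rw [Zhelobenko.pairingIn_eq_zero_of_middle hG hδ hδ']; norm_num) hδ
    exact ⟨⟨δ, h1⟩, hδ.trans (add_comm _ _), h2⟩
  · intro α γ h _
    exact Zhelobenko.op_corootElt_eq_zero hG γ.2 h
  · intro n e ε _ hC hsub hlast
    have hJ := Zhelobenko.isCompatible_corootElt (b := b) hG
    have hε := Zhelobenko.isEpsilonBasis_typeB (e := e) hC hsub hlast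
    constructor
    · intro i j k hji hk
      obtain ⟨γ, h1, h2, h3⟩ := hJ.down hε (j := j) (i - j) i k (by omega) hk
      exact ⟨⟨γ, h1⟩, h2, h3⟩
    · intro i j hji
      obtain ⟨γ, h1, h2, h3⟩ := hJ.upDown_typeB hε rfl hlast (n - (i + 1)) i (by omega) hji
      exact ⟨⟨γ, h1⟩, h2, h3⟩
  · intro n e ε _ hC hsub hlast
    have hJ := Zhelobenko.isCompatible_corootElt (b := b) hG
    have hε := Zhelobenko.isEpsilonBasis_typeC (e := e) hC hsub hlast
    have hs : Zhelobenko.IsSimplyLacedBeforeLast b.cartanMatrix (fun i ↦ e i) := by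
      refine ⟨fun i j hj hn ↦ ?_, fun i j hj ↦ ?_⟩ <;> rw [hC, hC] <;>
        simp only [CartanMatrix.C, Matrix.of_apply, Fin.ext_iff] <;>
        split_ifs <;> omega
    have hs2 : ∀ i j : Fin n, j.val = i.val + 1 → j.val + 1 = n →
        b.cartanMatrix (e i) (e j) * b.cartanMatrix (e j) (e i) = 2 := by
      intro i j hj hn
      rw [hC, hC]
      simp only [CartanMatrix.C, Matrix.of_apply, Fin.ext_iff]
      split_ifs <;> omega
    refine ⟨?_, ?_, ?_⟩
    · intro i j k hji hk
      obtain ⟨γ, h1, h2, h3⟩ := hJ.down hε (j := j) (i - j) i k (by omega) hk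
      exact ⟨⟨γ, h1⟩, h2, h3⟩
    · intro i j k hij hj
      obtain ⟨γ, h1, h2, h3⟩ := hJ.upDown_typeC hε hs hs2 hlast hj (k - i) i (by omega)
      exact ⟨⟨γ, h1⟩, h2, h3⟩
    · intro i k hk
      obtain ⟨γ, h1, h2, h3⟩ := hJ.upDown_epsilon hε hlast hk (n - (i + 1)) i (by omega)
      exact ⟨⟨γ, h1⟩, h2, h3⟩
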